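/- Let $g$ be a Lorentz inner product on $\mathbb R^4$, i.e. a real symmetric $4\times4$ matrix with $\det g<0$. A (Lorentz) bivector is a matrix $L$ with $L^Tg+gL=0$; it is simple if $L=uv^Tg-vu^Tg$ for some $u,v\in\mathbb R^4$, and nonsimple otherwise. Let $SO^+(g)$ be the identity component of $\{\Lambda:\Lambda^Tg\Lambda=g,\ \det\Lambda=1\}$, and call $\Lambda\in SO^+(g)$ simple if $\Lambda=\exp(L)$ for some simple bivector $L$, and nonsimple otherwise. Let $\mathrm{tr}_kM$ denote the coefficient of $t^k$ in $\det(I+tM)$. For a nonsimple bivector $L$ put $$\mu_\pm(L)=\tfrac12\Bigl(-\mathrm{tr}_2L\pm\sqrt{(\mathrm{tr}_2L)^2-4\det L}\Bigr),\qquad P_\pm(L)=\pm\frac{L^2-\mu_\mp(L)I}{\mu_+(L)-\mu_-(L)},$$ the projections of the orthogonal decomposition $L=P_+(L)L+P_-(L)L$ of $L$ (here $\mu_-(L)<\mu_+(L)$). Theorem. Let $\Lambda\in SO^+(g)$ be nonsimple and put $\Delta=(\mathrm{tr}\,\Lambda)^2-4\,\mathrm{tr}_2\Lambda+8$. Then $\Delta\ge0$,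 $\tfrac14(\mathrm{tr}\,\Lambda+\sqrt\Delta)\ge1$ and $\tfrac14(\mathrm{tr}\,\Lambda-\sqrt\Delta)\in[-1,1]$, so that $$x=\cosh^{-1}\tfrac14(\mathrm{tr}\,\Lambda+\sqrt\Delta)\ge0,\quad y=\cos^{-1}\tfrac14(\mathrm{tr}\,\Lambda-\sqrt\Delta)\in[0,\pi],\quad c_+=\cosh x,\quad c_-=\cos y$$ are well defined; moreover $c_-<c_+$. There is a nonsimple bivector $L$ with $\Lambda=\exp(L)$, $\sqrt{\mu_+(L)}=x$ and $\sqrt{-\mu_-(L)}=y$. For this $L$, and indeed for every nonsimple bivector $L$ with $\exp(L)=\Lambda$, the projections are $$P_\pm(L)=\pm\frac{\tfrac12(\Lambda+\Lambda^{-1})-c_\mp I}{c_+-c_-}.$$ -/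

import Mathlib

noncomputable section

namespace LorentzBivector

open Matrix Polynomial

/-- Real `4 × 4` matrices. -/
abbrev Mat4 : Type := Matrix (Fin 4) (Fin 4) ℝ

/-- The `k`-th order trace `tr_k M`: the coefficient of `t ^ k` in `det (I + t M)`. -/
def genTrace (k : ℕ) (M : Mat4) : ℝ :=
  (Matrix.det (1 + (X : ℝ[X]) • M.map (C : ℝ →+* ℝ[X]))).coeff k

/-- `g` is (the Gram matrix of) a Lorentz inner product on `ℝ⁴`: symmetric, nondegenerate, with
negative determinant (nondegeneracy is implied by `det g < 0`). -/
def IsLorentzMetric (g : Mat4) : Prop :=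
  g.IsSymm ∧ g.det < 0

/-- Membership in the Lorentz algebra `so(g)`: `Lᵀ g + g L = 0`. -/
def IsBivector (g L : Mat4) : Prop :=
  Lᵀ * g + g * L = 0

/-- The simple Lorentz bivector `u ∧ᵍ v = u vᵀ g - v uᵀ g`. -/
def wedge (g : Mat4) (u v : Fin 4 → ℝ) : Mat4 :=
  vecMulVec u v * g - vecMulVec v u * g

/-- `L` is a simple Lorentz bivector. -/
def IsSimpleBivector (g L : Mat4) : Prop :=
  ∃ u v : Fin 4 → ℝ, L = wedge g u v

/-- `L` is a nonsimple Lorentz bivector. -/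
def IsNonsimpleBivector (g L : Mat4) : Prop :=
  IsBivector g L ∧ ¬ IsSimpleBivector g L

/-- The proper Lorentz group: matrices with `Λᵀ g Λ = g` and `det Λ = 1`. -/
def properLorentz (g : Mat4) : Set Mat4 :=
  {Λ | Λᵀ * g * Λ = g ∧ Λ.det = 1}

/-- The proper orthochronous Lorentz group `SO⁺(g)`: the identity component of the proper
Lorentz group. -/
def properOrthochronous (g : Mat4) : Set Mat4 :=
  connectedComponentIn (properLorentz g) 1

/-- A Lorentz transformation is simple if it is the exponential of a simple bivector. -/
def IsSimpleLorentz (g Λ : Mat4) : Prop :=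
  ∃ L : Mat4, IsSimpleBivector g L ∧ Λ = NormedSpace.exp L

/-- `μ₊(L)`, the larger root of `x² + (tr₂ L) x + det L`. -/
def muPlus (L : Mat4) : ℝ :=
  (-genTrace 2 L + √(genTrace 2 L ^ 2 - 4 * L.det)) / 2

/-- `μ₋(L)`, the smaller root of `x² + (tr₂ L) x + det L`. -/
def muMinus (L : Mat4) : ℝ :=
  (-genTrace 2 L - √(genTrace 2 L ^ 2 - 4 * L.det)) / 2

/-- The projection `P₊ = (L² - μ₋ I) / (μ₊ - μ₋)` of the orthogonal decomposition of `L`. -/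
def projPlus (L : Mat4) : Mat4 :=
  (muPlus L - muMinus L)⁻¹ • (L ^ 2 - muMinus L • (1 : Mat4))

/-- The projection `P₋ = -(L² - μ₊ I) / (μ₊ - μ₋)` of the orthogonal decomposition of `L`. -/
def projMinus (L : Mat4) : Mat4 :=
  -((muPlus L - muMinus L)⁻¹ • (L ^ 2 - muPlus L • (1 : Mat4)))

/-- `Δ = (tr Λ)² - 4 tr₂ Λ + 8`. -/
def lorentzDisc (Λ : Mat4) : ℝ :=
  Λ.trace ^ 2 - 4 * genTrace 2 Λ + 8

/-- `√μ₊ = cosh⁻¹ (¼ (tr Λ + √Δ))`, as a function of `Λ`. -/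
def rapidity (Λ : Mat4) : ℝ :=
  Real.arcosh ((Λ.trace + √(lorentzDisc Λ)) / 4)

/-- `√(-μ₋) = cos⁻¹ (¼ (tr Λ - √Δ))`, as a function of `Λ`. -/
def angle (Λ : Mat4) : ℝ :=
  Real.arccos ((Λ.trace - √(lorentzDisc Λ)) / 4)

/-- `c₊ = cosh √μ₊`. -/
def cPlus (Λ : Mat4) : ℝ := Real.cosh (rapidity Λ)

/-- `c₋ = cos √(-μ₋)`. -/
def cMinus (Λ : Mat4) : ℝ := Real.cos (angle Λ)

end LorentzBivector

end

noncomputable section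

namespace LorentzBivector

open Matrix Polynomial

/-! Split `Λ = A + B` with `A = ½(Λ + Λ⁻¹)` self-adjoint for `g` and `B = ½(Λ - Λ⁻¹)` a bivector;
they commute and `B² = A² - 1`. The characteristic polynomial of `Λ` is palindromic, so `A`
satisfies a quadratic with roots `p, q = ¼(tr Λ ± √Δ)` (`evenPart_quadratic`). A bivector has `det ≤
0`, since `g * L` is antisymmetric and `det g < 0`; applied to `B` this gives `Δ ≥ 0` and `(1 -
p²)(1 - q²) ≤ 0`. Preservation of time orientation then forces `p ≥ 1` and `|q| ≤ 1`
(`IsEvenOddPair.bounds`).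

If `p = q`, `p = 1` or `q = 1`, an explicit simple logarithm exists, so nonsimplicity leaves `q < 1
< p`. The spectral projections `P, Q` of `A` then carry a boost generator `K² = P` and a rotation
generator `J² = -Q`, and `L = arcosh p • K + arccos q • J` exponentiates to `A + B`
(`IsEvenOddPair.exists_log`).

Conversely, for any nonsimple logarithm `L` the even part of `exp L` is `cosh √μ₊ P₊ + cos √(-μ₋)
P₋`. Thus `L²` and `A` share spectral projections, which is the projection formula
(`IsNonsimpleBivector.eig_exp`). -/

/-! ### Traces and characteristic polynomials. -/

theorem det_fin_four {R : Type*} [CommRing R] (A : Matrix (Fin 4) (Fin 4) R) : A.det =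
    (A 0 0 * A 1 1 - A 0 1 * A 1 0) * (A 2 2 * A 3 3 - A 2 3 * A 3 2)
    - (A 0 0 * A 1 2 - A 0 2 * A 1 0) * (A 2 1 * A 3 3 - A 2 3 * A 3 1)
    + (A 0 0 * A 1 3 - A 0 3 * A 1 0) * (A 2 1 * A 3 2 - A 2 2 * A 3 1)
    + (A 0 1 * A 1 2 - A 0 2 * A 1 1) * (A 2 0 * A 3 3 - A 2 3 * A 3 0)
    - (A 0 1 * A 1 3 - A 0 3 * A 1 1) * (A 2 0 * A 3 2 - A 2 2 * A 3 0)
    + (A 0 2 * A 1 3 - A 0 3 * A 1 2) * (A 2 0 * A 3 1 - A 2 1 * A 3 0) := by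
  rw [det_succ_row_zero]
  simp only [Fin.sum_univ_four, det_fin_three, submatrix_apply]
  norm_num [Fin.succAbove, ← Fin.val_fin_lt]
  simp only [show Fin.succ (2 : Fin 3) = 3 from rfl, show Fin.castSucc (2 : Fin 3) = 2 from rfl]
  ring

/-- The third elementary symmetric function of the eigenvalues. -/
def thirdTrace (M : Mat4) : ℝ :=
  (1 + M).det - 1 - M.trace - (M.trace ^ 2 - (M * M).trace) / 2 - M.det

/-- The homogeneous form specialises both to `det (1 + tM)` and to the characteristic polynomial. -/
theorem det_smul_add_smul (M : Mat4) (x y : ℝ) : (y • (1 : Mat4) + x • M).det =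
    y ^ 4 + M.trace * x * y ^ 3 + (M.trace ^ 2 - (M * M).trace) / 2 * x ^ 2 * y ^ 2 +
      thirdTrace M * x ^ 3 * y + M.det * x ^ 4 := by
  simp only [thirdTrace, det_fin_four, Matrix.trace, diag_apply, Matrix.mul_apply,
    Fin.sum_univ_four, Matrix.add_apply, Matrix.smul_apply, smul_eq_mul, Matrix.one_apply,
    Fin.reduceEq, if_true, if_false]
  ring

theorem genTrace_two (M : Mat4) : genTrace 2 M = (M.trace ^ 2 - (M * M).trace) / 2 := by
  have h : Matrix.det (1 + (X : ℝ[X]) • M.map (C : ℝ →+* ℝ[X])) =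
      C 1 + C M.trace * X + C ((M.trace ^ 2 - (M * M).trace) / 2) * X ^ 2 +
        C (thirdTrace M) * X ^ 3 + C M.det * X ^ 4 := by
    refine Polynomial.funext fun x => ?_
    have h1 := det_smul_add_smul M x 1
    have h2 : ((evalRingHom x).mapMatrix (1 + (X : ℝ[X]) • M.map (C : ℝ →+* ℝ[X]))) =
        (1 : ℝ) • (1 : Mat4) + x • M := by
      ext i j
      by_cases hij : i = j <;> simp [hij] <;> ring
    have h3 := (evalRingHom x).map_det (1 + (X : ℝ[X]) • M.map (C : ℝ →+* ℝ[X]))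
    rw [h2, h1] at h3
    rw [coe_evalRingHom] at h3
    rw [h3]
    simp
  rw [genTrace, h]
  simp [coeff_one, coeff_X_pow]

theorem charpoly_eq (M : Mat4) : M.charpoly =
    X ^ 4 - C M.trace * X ^ 3 + C (genTrace 2 M) * X ^ 2 - C (thirdTrace M) * X + C M.det := by
  refine Polynomial.funext fun x => ?_
  have h1 := det_smul_add_smul M (-1) x
  rw [eval_charpoly, genTrace_two]
  have h2 : scalar (Fin 4) x - M = x • (1 : Mat4) + (-1 : ℝ) • M := by
    rw [smul_one_eq_diagonal, neg_one_smul, sub_eq_add_neg]; rfl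
  rw [h2, h1]
  simp
  ring

theorem cayleyHamilton (M : Mat4) : M ^ 4 - M.trace • M ^ 3 + genTrace 2 M • M ^ 2
    - thirdTrace M • M + M.det • (1 : Mat4) = 0 := by
  have h := aeval_self_charpoly M
  rw [charpoly_eq] at h
  simpa [Algebra.smul_def] using h

theorem thirdTrace_congr {M N : Mat4} (h : M.charpoly = N.charpoly) :
    thirdTrace M = thirdTrace N := by
  have := congrArg (fun p => coeff p 1) h
  simpa [charpoly_eq, coeff_X, coeff_C, coeff_X_pow] using this

theorem trace_congr {M N : Mat4} (h : M.charpoly = N.charpoly) : M.trace = N.trace := by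
  have := congrArg (fun p => coeff p 3) h
  simpa [charpoly_eq, coeff_X, coeff_C, coeff_X_pow] using this

theorem thirdTrace_neg (M : Mat4) : thirdTrace (-M) = - thirdTrace M := by
  have h1 := det_smul_add_smul M 1 1
  have h2 := det_smul_add_smul M (-1) 1
  simp only [thirdTrace] at *
  rw [show (-M).det = M.det by simp [det_neg]; norm_num]
  simp only [one_smul, neg_one_smul, trace_neg, neg_mul_neg] at *
  linarith

/-- Inversion reverses the coefficients: `det (x + M⁻¹) = det (1 + xM)` when `det M = 1`. -/
theorem thirdTrace_eq_trace {M N : Mat4} (h : M * N = 1) (hd : M.det = 1) :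
    thirdTrace M = N.trace := by
  have key : ∀ x : ℝ, (x • (1 : Mat4) + (1 : ℝ) • N).det = ((1 : ℝ) • (1 : Mat4) + x • M).det := by
    intro x
    have := congrArg det (show M * (x • (1 : Mat4) + (1 : ℝ) • N) = (1 : ℝ) • (1 : Mat4) + x • M by
      rw [mul_add, Matrix.mul_smul, Matrix.mul_smul, h, mul_one, add_comm])
    rwa [det_mul, hd, one_mul] at this
  simp only [det_smul_add_smul] at key
  -- The `x⁴` terms cancel, so four sample points determine the remaining cubic identity.
  linarith [key 0, key 1, key (-1), key 2]

/-! ### Bivectors: vanishing odd traces, sign of the determinant, simplicity. -/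

theorem isBivector_iff {g L : Mat4} : IsBivector g L ↔ Lᵀ * g = -(g * L) :=
  eq_neg_iff_add_eq_zero.symm

theorem IsBivector.smul {g L : Mat4} (h : IsBivector g L) (c : ℝ) : IsBivector g (c • L) := by
  rw [IsBivector] at *
  rw [transpose_smul, Matrix.smul_mul, Matrix.mul_smul, ← smul_add, h, smul_zero]

theorem IsBivector.add {g L M : Mat4} (h : IsBivector g L) (h' : IsBivector g M) :
    IsBivector g (L + M) := by
  rw [isBivector_iff] at *
  rw [transpose_add, add_mul, h, h', mul_add, neg_add]

theorem isBivector_wedge {g : Mat4} (hg : g.IsSymm) (u v : Fin 4 → ℝ) :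
    IsBivector g (wedge g u v) := by
  rw [isBivector_iff, wedge]
  simp only [transpose_sub, transpose_mul, transpose_vecMulVec, hg.eq]
  noncomm_ring

/-- `-L` is conjugate by `g` to `Lᵀ`. Hence the odd coefficients of the characteristic polynomial
vanish. -/
theorem IsBivector.charpoly_neg {g L : Mat4} (hd : IsUnit g.det) (h : IsBivector g L) :
    (-L).charpoly = L.charpoly := by
  rw [isBivector_iff] at h
  obtain ⟨G, rfl⟩ := (Matrix.isUnit_iff_isUnit_det g).2 hd
  rw [← charpoly_transpose L, ← charpoly_units_conj G (-L)]
  congr 1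
  rw [mul_neg, ← h, mul_assoc]
  simp

theorem IsBivector.trace_eq_zero {g L : Mat4} (hd : IsUnit g.det) (h : IsBivector g L) :
    L.trace = 0 := by
  have := trace_congr (h.charpoly_neg hd)
  rw [trace_neg] at this
  linarith

theorem IsBivector.thirdTrace_eq_zero {g L : Mat4} (hd : IsUnit g.det) (h : IsBivector g L) :
    thirdTrace L = 0 := by
  have := thirdTrace_congr (h.charpoly_neg hd)
  rw [thirdTrace_neg] at this
  linarith

theorem IsBivector.cayleyHamilton {g L : Mat4} (hd : IsUnit g.det) (h : IsBivector g L) :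
    L ^ 4 + genTrace 2 L • L ^ 2 + L.det • (1 : Mat4) = 0 := by
  have := LorentzBivector.cayleyHamilton L
  simpa [h.trace_eq_zero hd, h.thirdTrace_eq_zero hd] using this

theorem IsBivector.genTrace_two {g L : Mat4} (hd : IsUnit g.det) (h : IsBivector g L) :
    genTrace 2 L = -(L * L).trace / 2 := by
  rw [LorentzBivector.genTrace_two, h.trace_eq_zero hd]
  ring

/-- The base of the square is the Pfaffian. -/
theorem det_eq_sq_of_antisymm {F : Mat4} (h : Fᵀ = -F) :
    F.det = (F 0 1 * F 2 3 - F 0 2 * F 1 3 + F 0 3 * F 1 2) ^ 2 := by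
  have h' : ∀ i j, F j i = - F i j := fun i j => congrFun (congrFun h i) j
  have hd : ∀ i, F i i = 0 := fun i => by have := h' i i; linarith
  rw [det_fin_four, h' 0 1, h' 0 2, h' 0 3, h' 1 2, h' 1 3, h' 2 3]
  simp only [hd]
  ring

theorem IsBivector.det_nonpos {g L : Mat4} (hg : IsLorentzMetric g) (h : IsBivector g L) :
    L.det ≤ 0 := by
  rw [isBivector_iff] at h
  have h1 : (g * L)ᵀ = -(g * L) := by rw [transpose_mul, hg.1.eq, h]
  have h2 := det_eq_sq_of_antisymm h1
  rw [det_mul] at h2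
  have h3 := hg.2
  by_contra! h4
  have : g.det * L.det < 0 := mul_neg_of_neg_of_pos h3 h4
  rw [h2] at this
  exact absurd this (not_lt.2 (sq_nonneg _))

theorem pluecker_of_antisymm {F : Mat4} (h : Fᵀ = -F)
    (hp : F 0 1 * F 2 3 - F 0 2 * F 1 3 + F 0 3 * F 1 2 = 0) (i j k l : Fin 4) :
    F i j * F k l - F i k * F j l + F i l * F j k = 0 := by
  have h' : ∀ i j, F j i = - F i j := fun i j => congrFun (congrFun h i) j
  have hd : ∀ i, F i i = 0 := fun i => by have := h' i i; linarith
  have h01 := h' 0 1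
  have h02 := h' 0 2
  have h03 := h' 0 3
  have h12 := h' 1 2
  have h13 := h' 1 3
  have h23 := h' 2 3
  fin_cases i <;> fin_cases j <;> fin_cases k <;> fin_cases l <;>
    simp only [Fin.zero_eta, Fin.mk_one, Fin.reduceFinMk, hd, h01, h02, h03, h12, h13, h23] <;>
    first | ring1 | linear_combination hp | linear_combination -hp

/-- A zero Pfaffian is the Plücker relation in dimension four, so `F` is decomposable: its columns
`i` and `j`, for any `F i j ≠ 0`, span it. -/
theorem exists_vecMulVec_sub_of_antisymm {F : Mat4} (h : Fᵀ = -F) (hdet : F.det = 0) :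
    ∃ u v : Fin 4 → ℝ, F = vecMulVec u v - vecMulVec v u := by
  rw [det_eq_sq_of_antisymm h] at hdet
  have hp := pluecker_of_antisymm h (pow_eq_zero_iff two_ne_zero |>.1 hdet)
  have h' : ∀ i j, F j i = - F i j := fun i j => congrFun (congrFun h i) j
  by_cases hF : F = 0
  · exact ⟨0, 0, by simp [hF]⟩
  obtain ⟨i, j, hij⟩ : ∃ i j, F i j ≠ 0 := by
    by_contra! hc
    exact hF (Matrix.ext hc)
  refine ⟨fun k => F k i / F i j, fun k => F k j, Matrix.ext fun k l => ?_⟩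
  simp only [Matrix.sub_apply, vecMulVec_apply]
  have h1 : F i j * F k l = F k i * F l j - F k j * F l i := by
    rw [h' i k, h' j l, h' j k, h' i l]
    linear_combination hp i j k l
  rw [div_mul_eq_mul_div, mul_div_assoc', ← sub_div, ← h1, mul_div_cancel_left₀ _ hij]

theorem IsBivector.isSimple {g L : Mat4} (hs : g.IsSymm) (hd : IsUnit g.det) (h : IsBivector g L)
    (hL : L.det = 0) : IsSimpleBivector g L := by
  rw [isBivector_iff] at h
  have h1 : (L * g⁻¹)ᵀ = -(L * g⁻¹) := by
    rw [transpose_mul, transpose_nonsing_inv, hs.eq]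
    calc g⁻¹ * Lᵀ = g⁻¹ * (Lᵀ * g) * g⁻¹ := by
          rw [mul_assoc, mul_assoc Lᵀ, mul_nonsing_inv _ hd, mul_one]
      _ = -(L * g⁻¹) := by
          rw [h, mul_neg, nonsing_inv_mul_cancel_left _ _ hd, neg_mul]
  obtain ⟨u, v, huv⟩ := exists_vecMulVec_sub_of_antisymm h1 (by rw [det_mul, hL, zero_mul])
  refine ⟨u, v, ?_⟩
  rw [wedge, ← sub_mul, ← huv, mul_assoc, nonsing_inv_mul _ hd, mul_one]

theorem det_wedge (g : Mat4) (u v : Fin 4 → ℝ) : (wedge g u v).det = 0 := by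
  rw [wedge, ← sub_mul, det_mul]
  have : (vecMulVec u v - vecMulVec v u).det = 0 := by
    simp only [det_fin_four, Matrix.sub_apply, vecMulVec_apply]
    ring
  rw [this, zero_mul]

/-! ### The Lorentz form and its signature. -/

/-- The bilinear form with Gram matrix `g`. -/
def form (g : Mat4) (u v : Fin 4 → ℝ) : ℝ := u ⬝ᵥ g *ᵥ v

theorem form_comm {g : Mat4} (hg : g.IsSymm) (u v : Fin 4 → ℝ) : form g u v = form g v u := by
  rw [form, form, dotProduct_comm, ← vecMul_transpose, hg.eq, dotProduct_mulVec]

theorem form_mulVec_left (g M : Mat4) (u v : Fin 4 → ℝ) :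
    form g (M *ᵥ u) v = u ⬝ᵥ (Mᵀ * g) *ᵥ v := by
  rw [form, ← vecMul_transpose, ← dotProduct_mulVec, mulVec_mulVec]

theorem form_mulVec_right (g M : Mat4) (u v : Fin 4 → ℝ) :
    form g u (M *ᵥ v) = u ⬝ᵥ (g * M) *ᵥ v := by
  rw [form, mulVec_mulVec]

theorem form_add_left (g : Mat4) (u v w : Fin 4 → ℝ) :
    form g (u + v) w = form g u w + form g v w := add_dotProduct _ _ _

theorem form_add_right (g : Mat4) (u v w : Fin 4 → ℝ) :
    form g u (v + w) = form g u v + form g u w := by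
  rw [form, mulVec_add, dotProduct_add]; rfl

theorem form_sub_left (g : Mat4) (u v w : Fin 4 → ℝ) :
    form g (u - v) w = form g u w - form g v w := sub_dotProduct _ _ _

theorem form_sub_right (g : Mat4) (u v w : Fin 4 → ℝ) :
    form g u (v - w) = form g u v - form g u w := by
  rw [form, mulVec_sub, dotProduct_sub]; rfl

theorem form_smul_left (g : Mat4) (c : ℝ) (u v : Fin 4 → ℝ) :
    form g (c • u) v = c * form g u v := smul_dotProduct _ _ _

theorem form_smul_right (g : Mat4) (c : ℝ) (u v : Fin 4 → ℝ) :
    form g u (c • v) = c * form g u v := by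
  rw [form, mulVec_smul, dotProduct_smul]; rfl

theorem form_zero_left (g : Mat4) (u : Fin 4 → ℝ) : form g 0 u = 0 := zero_dotProduct _

theorem form_neg (g : Mat4) (u v : Fin 4 → ℝ) : form (-g) u v = - form g u v := by
  rw [form, neg_mulVec, dotProduct_neg]; rfl

theorem IsBivector.form_mulVec {g L : Mat4} (h : IsBivector g L) (u v : Fin 4 → ℝ) :
    form g (L *ᵥ u) v = - form g u (L *ᵥ v) := by
  rw [form_mulVec_left, isBivector_iff.1 h, form_mulVec_right, neg_mulVec, dotProduct_neg]

/-- `g` has signature `(-, +, +, +)`. -/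
def IsMostlyPlus (g : Mat4) : Prop :=
  ∃ e, form g e e < 0 ∧ ∀ w, w ≠ 0 → form g e w = 0 → 0 < form g w w

theorem IsMostlyPlus.pos_of_orthogonal {g : Mat4} (hs : g.IsSymm) (hg : IsMostlyPlus g)
    {v w : Fin 4 → ℝ} (hv : form g v v < 0) (hw : w ≠ 0) (hvw : form g v w = 0) :
    0 < form g w w := by
  obtain ⟨e, -, h⟩ := hg
  by_contra! hc
  -- If `g(w, w) ≤ 0`, the form is nonpositive on the span of `v` and `w`; this combination lies in
  -- that span and is orthogonal to `e`, so it must vanish.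
  have hx : form g e w • v - form g e v • w = 0 := by
    by_contra hne
    have h1 := h _ hne (by simp only [form_sub_right, form_smul_right]; ring)
    simp only [form_sub_right, form_smul_right, form_sub_left, form_smul_left,
      form_comm hs w v, hvw] at h1
    nlinarith [sq_nonneg (form g e w), sq_nonneg (form g e v), mul_nonneg (sq_nonneg (form g e w))
      (neg_nonneg.2 hv.le), mul_nonneg (sq_nonneg (form g e v)) (neg_nonneg.2 hc)]
  have h2 : form g v (form g e w • v - form g e v • w) = 0 := by
    rw [hx, form_comm hs, form_zero_left]
  rw [form_sub_right, form_smul_right, form_smul_right, hvw, mul_zero, sub_zero] at h2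
  have h3 : form g e w = 0 := (mul_eq_zero.1 h2).resolve_right hv.ne
  exact absurd (h w hw h3) (not_lt.2 hc)

theorem IsMostlyPlus.nonneg_of_orthogonal {g : Mat4} (hs : g.IsSymm) (hg : IsMostlyPlus g)
    {v w : Fin 4 → ℝ} (hv : form g v v < 0) (hvw : form g v w = 0) :
    0 ≤ form g w w := by
  by_cases hw : w = 0
  · rw [hw, form_zero_left]
  · exact (hg.pos_of_orthogonal hs hv hw hvw).le

/-- The image of `L` consists of null vectors, and a null vector orthogonal to the timelike `e` is
zero. This kills first `L e`, then, by skewness, every `L v`. -/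
theorem IsBivector.eq_zero_of_sq {g L : Mat4} (hs : g.IsSymm) (hg : IsMostlyPlus g)
    (h : IsBivector g L) (hL : L * L = 0) : L = 0 := by
  have hnull : ∀ v, form g (L *ᵥ v) (L *ᵥ v) = 0 := fun v => by
    rw [h.form_mulVec, mulVec_mulVec, hL, zero_mulVec, form_comm hs, form_zero_left, neg_zero]
  obtain ⟨e, he, -⟩ := id hg
  have key : ∀ v, form g e (L *ᵥ v) = 0 → L *ᵥ v = 0 := fun v hv => by
    by_contra hne
    exact (hg.pos_of_orthogonal hs he hne hv).ne' (hnull v)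
  have h1 : L *ᵥ e = 0 := key e <| by
    have := h.form_mulVec e e
    rw [form_comm hs] at this
    linarith
  refine Matrix.ext_of_mulVec_single fun i => ?_
  rw [zero_mulVec]
  refine key _ ?_
  have := h.form_mulVec e (Pi.single i 1)
  rw [h1, form_zero_left] at this
  linarith

theorem isMostlyPlus_of_diagonalization {U : Mat4} {l : Fin 4 → ℝ} (hU : U * Uᵀ = 1) (i : Fin 4)
    (hi : l i < 0) (hpos : ∀ j, j ≠ i → 0 < l j) : IsMostlyPlus (U * diagonal l * Uᵀ) := by
  have hU' : Uᵀ * U = 1 := mul_eq_one_comm.1 hU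
  have key : ∀ u v, form (U * diagonal l * Uᵀ) u v = ∑ j, l j * (Uᵀ *ᵥ u) j * (Uᵀ *ᵥ v) j := by
    intro u v
    rw [form, ← mulVec_mulVec, ← mulVec_mulVec, dotProduct_mulVec, ← mulVec_transpose]
    simp only [dotProduct, mulVec_diagonal]
    exact Finset.sum_congr rfl fun _ _ => by ring
  have he : Uᵀ *ᵥ (U *ᵥ Pi.single i 1) = Pi.single i 1 := by
    rw [mulVec_mulVec, hU', one_mulVec]
  refine ⟨U *ᵥ Pi.single i 1, ?_, fun w hw h => ?_⟩
  · rw [key, he, Finset.sum_eq_single i] <;> simp +contextual [hi]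
  · rw [key, he, Finset.sum_eq_single i] at h
    · have hwi : (Uᵀ *ᵥ w) i = 0 := by simpa [hi.ne] using h
      have hw' : Uᵀ *ᵥ w ≠ 0 := fun h0 => hw <| by
        rw [← one_mulVec w, ← hU, ← mulVec_mulVec, h0, mulVec_zero]
      obtain ⟨j, hj⟩ := Function.ne_iff.1 hw'
      rw [key]
      refine Finset.sum_pos' (fun k _ => ?_) ⟨j, Finset.mem_univ _, ?_⟩
      · by_cases hk : k = i
        · rw [hk, hwi, mul_zero]
        · have := hpos k hk
          rw [mul_assoc]
          exact mul_nonneg this.le (mul_self_nonneg _)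
      · have hji : j ≠ i := fun h => hj (by rw [h, hwi]; rfl)
        rw [mul_assoc]
        exact mul_pos (hpos j hji) (mul_self_pos.2 hj)
    · simp +contextual
    · simp

/-- An odd number of the four factors is negative, namely one or three. -/
theorem exists_single_sign {l : Fin 4 → ℝ} (h : ∏ i, l i < 0) :
    ∃ i, (l i < 0 ∧ ∀ j, j ≠ i → 0 < l j) ∨ (0 < l i ∧ ∀ j, j ≠ i → l j < 0) := by
  have hne : ∀ i, l i ≠ 0 := fun i hi => h.ne (Finset.prod_eq_zero (Finset.mem_univ i) hi)
  rw [Fin.prod_univ_four] at h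
  simp only [Fin.exists_fin_succ, Fin.forall_fin_succ]
  rcases (hne 0).lt_or_gt with h0 | h0 <;> rcases (hne 1).lt_or_gt with h1 | h1 <;>
  rcases (hne 2).lt_or_gt with h2 | h2 <;> rcases (hne 3).lt_or_gt with h3 | h3 <;>
  first
  | simp [h0, h1, h2, h3]
    done
  | exfalso
    rw [mul_assoc] at h
    first
    | exact h.not_gt (mul_pos
        (by first | exact mul_pos h0 h1 | exact mul_pos_of_neg_of_neg h0 h1)
        (by first | exact mul_pos h2 h3 | exact mul_pos_of_neg_of_neg h2 h3))
    | exact h.not_gt (mul_pos_of_neg_of_neg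
        (by first | exact mul_neg_of_pos_of_neg h0 h1 | exact mul_neg_of_neg_of_pos h0 h1)
        (by first | exact mul_neg_of_pos_of_neg h2 h3 | exact mul_neg_of_neg_of_pos h2 h3))

theorem isMostlyPlus_or_neg {g : Mat4} (hg : IsLorentzMetric g) :
    IsMostlyPlus g ∨ IsMostlyPlus (-g) := by
  have hH : g.IsHermitian := by
    rw [IsHermitian, conjTranspose_eq_transpose_of_trivial, hg.1.eq]
  have hdet := hg.2
  rw [hH.det_eq_prod_eigenvalues] at hdet
  obtain ⟨i, hi⟩ := exists_single_sign (l := hH.eigenvalues) (by simpa using hdet)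
  obtain ⟨U, hU, hgU⟩ : ∃ U : Mat4, U * Uᵀ = 1 ∧ g = U * diagonal hH.eigenvalues * Uᵀ := by
    refine ⟨hH.eigenvectorUnitary, ?_, ?_⟩
    · have := (Matrix.mem_unitaryGroup_iff).1 hH.eigenvectorUnitary.2
      rwa [star_eq_conjTranspose, conjTranspose_eq_transpose_of_trivial] at this
    · have := hH.spectral_theorem
      rwa [Unitary.conjStarAlgAut_apply, star_eq_conjTranspose,
        conjTranspose_eq_transpose_of_trivial] at this
  rcases hi with hi | hi
  · left
    rw [hgU]
    exact isMostlyPlus_of_diagonalization hU i hi.1 hi.2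
  · right
    have h2 := isMostlyPlus_of_diagonalization (l := -hH.eigenvalues) hU i
      (by simpa using hi.1) (by simpa using hi.2)
    rwa [show diagonal (-hH.eigenvalues) = -diagonal hH.eigenvalues from (diagonal_neg _).symm,
      mul_neg, neg_mul, ← hgU] at h2

/-! ### Closed forms for exponentials. -/

section exponential

open scoped Matrix.Norms.Operator

/-- Uniqueness for the linear equation `G' = L G`: `exp(-tL) G(t)` has zero derivative. -/
theorem exp_eq_of_hasDerivAt {L : Mat4} {G : ℝ → Mat4} (hG : ∀ t, HasDerivAt G (L * G t) t)
    (h0 : G 0 = 1) : NormedSpace.exp L = G 1 := by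
  have hf : ∀ t, HasDerivAt (fun t : ℝ => NormedSpace.exp (t • (-L)) * G t) 0 t := by
    intro t
    have := (hasDerivAt_exp_smul_const (-L) t).mul (hG t)
    refine this.congr_deriv ?_
    noncomm_ring
  have hc := is_const_of_deriv_eq_zero (fun t => (hf t).differentiableAt)
    (fun t => (hf t).deriv) 1 0
  simp only [one_smul, zero_smul, NormedSpace.exp_zero, h0, mul_one] at hc
  have h2 : NormedSpace.exp L * NormedSpace.exp (-L) = 1 := by
    rw [Matrix.exp_neg]
    exact mul_nonsing_inv _ ((Matrix.isUnit_iff_isUnit_det _).1 (Matrix.isUnit_exp L))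
  calc NormedSpace.exp L = NormedSpace.exp L * (NormedSpace.exp (-L) * G 1) := by rw [hc, mul_one]
    _ = G 1 := by rw [← mul_assoc, h2, one_mul]

/-- If `L` acts as a boost generator `a K` on the image of `P` and as a rotation generator `b J` on
the image of `Q`, then its exponential is given by hyperbolic and trigonometric functions. -/
theorem exp_eq_of_blocks {L P K Q J : Mat4} {a b : ℝ} (hP : L * P = a • K) (hK : L * K = a • P)
    (hQ : L * Q = b • J) (hJ : L * J = -(b • Q)) (h1 : P + Q = 1) :
    NormedSpace.exp L =
      Real.cosh a • P + Real.sinh a • K + Real.cos b • Q + Real.sin b • J := by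
  have := exp_eq_of_hasDerivAt (L := L) (G := fun t => Real.cosh (t * a) • P +
    Real.sinh (t * a) • K + Real.cos (t * b) • Q + Real.sin (t * b) • J) ?_ (by simp [h1])
  · simpa using this
  intro t
  have ha : HasDerivAt (fun t : ℝ => t * a) a t := by simpa using (hasDerivAt_id t).mul_const a
  have hb : HasDerivAt (fun t : ℝ => t * b) b t := by simpa using (hasDerivAt_id t).mul_const b
  have := (((ha.cosh.smul_const P).add (ha.sinh.smul_const K)).add
    (hb.cos.smul_const Q)).add (hb.sin.smul_const J)
  refine this.congr_deriv ?_
  simp only [mul_add, Matrix.mul_smul, hP, hK, hQ, hJ]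
  module

theorem exp_eq_of_cube_eq_zero {L : Mat4} (h : L * (L * L) = 0) :
    NormedSpace.exp L = 1 + L + (1 / 2 : ℝ) • (L * L) := by
  have := exp_eq_of_hasDerivAt (L := L)
    (G := fun t => 1 + t • L + (t ^ 2 / 2) • (L * L)) ?_ (by simp)
  · simpa using this
  intro t
  have h2 : HasDerivAt (fun t : ℝ => t ^ 2 / 2) t t := by
    simpa using (hasDerivAt_pow 2 t).div_const 2
  have := (((hasDerivAt_id t).smul_const L).const_add 1).add (h2.smul_const (L * L))
  refine this.congr_deriv ?_
  simp only [mul_add, Matrix.mul_smul, h, mul_one, smul_zero, add_zero, one_smul]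

end exponential

/-! ### Time orientation; even and odd parts of a Lorentz transformation. -/

/-- Orthochronous in the sense that no timelike vector changes its time orientation. -/
theorem form_mulVec_self_neg {g Λ : Mat4} (hs : g.IsSymm) (hg : IsMostlyPlus g)
    (hΛ : Λ ∈ properOrthochronous g) {v : Fin 4 → ℝ} (hv : form g v v < 0) :
    form g v (Λ *ᵥ v) < 0 := by
  have hsub : properOrthochronous g ⊆ properLorentz g := connectedComponentIn_subset _ _
  -- `M v` is timelike like `v`, hence not orthogonal to it; so on the component of `1` the
  -- continuous function `g(v, M v)` keeps its sign at `1`.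
  have hne : ∀ M ∈ properLorentz g, form g v (M *ᵥ v) ≠ 0 := by
    intro M hM h0
    have h1 := hg.nonneg_of_orthogonal hs hv h0
    rw [form_mulVec_left, mulVec_mulVec, hM.1] at h1
    exact absurd h1 (not_le.2 hv)
  have h1mem : (1 : Mat4) ∈ properLorentz g := by simp [properLorentz]
  have hconn : IsPreconnected ((fun M : Mat4 => form g v (M *ᵥ v)) '' properOrthochronous g) := by
    refine isPreconnected_connectedComponentIn.image _ (Continuous.continuousOn ?_)
    unfold form
    fun_prop
  by_contra! hc
  obtain ⟨M, hM, hM0⟩ := hconn.ordConnected.out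
    (Set.mem_image_of_mem _ (mem_connectedComponentIn h1mem)) (Set.mem_image_of_mem _ hΛ)
    (show (0 : ℝ) ∈ _ from ⟨by rw [one_mulVec]; exact hv.le, hc⟩)
  exact hne M (hsub hM) hM0

theorem mem_properLorentz {g Λ : Mat4} (hΛ : Λ ∈ properOrthochronous g) : Λ ∈ properLorentz g :=
  connectedComponentIn_subset _ _ hΛ

/-- The half sum of a Lorentz transformation and its inverse. -/
def evenPart (Λ : Mat4) : Mat4 := (1 / 2 : ℝ) • (Λ + Λ⁻¹)

/-- The half difference of a Lorentz transformation and its inverse. -/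
def oddPart (Λ : Mat4) : Mat4 := (1 / 2 : ℝ) • (Λ - Λ⁻¹)

theorem evenPart_add_oddPart (Λ : Mat4) : evenPart Λ + oddPart Λ = Λ := by
  rw [evenPart, oddPart]; module

theorem mul_inv_of_mem {g Λ : Mat4} (hΛ : Λ ∈ properLorentz g) : Λ * Λ⁻¹ = 1 :=
  mul_nonsing_inv _ (by rw [hΛ.2]; exact isUnit_one)

theorem inv_mul_of_mem {g Λ : Mat4} (hΛ : Λ ∈ properLorentz g) : Λ⁻¹ * Λ = 1 :=
  nonsing_inv_mul _ (by rw [hΛ.2]; exact isUnit_one)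

theorem transpose_mul_of_mem {g Λ : Mat4} (hΛ : Λ ∈ properLorentz g) : Λᵀ * g = g * Λ⁻¹ := by
  calc Λᵀ * g = Λᵀ * g * Λ * Λ⁻¹ := by rw [mul_assoc, mul_inv_of_mem hΛ, mul_one]
    _ = g * Λ⁻¹ := by rw [hΛ.1]

theorem inv_transpose_mul_of_mem {g Λ : Mat4} (hΛ : Λ ∈ properLorentz g) :
    Λ⁻¹ᵀ * g = g * Λ := by
  have : Λ⁻¹ᵀ * Λᵀ = 1 := by rw [← transpose_mul, mul_inv_of_mem hΛ, transpose_one]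
  calc Λ⁻¹ᵀ * g = Λ⁻¹ᵀ * (Λᵀ * g * Λ) := by rw [hΛ.1]
    _ = Λ⁻¹ᵀ * Λᵀ * g * Λ := by noncomm_ring
    _ = g * Λ := by rw [this, one_mul]

theorem trace_inv_of_mem {g Λ : Mat4} (hd : IsUnit g.det) (hΛ : Λ ∈ properLorentz g) :
    (Λ⁻¹).trace = Λ.trace := by
  have : Λ⁻¹ = g⁻¹ * Λᵀ * g := by
    rw [mul_assoc, transpose_mul_of_mem hΛ, nonsing_inv_mul_cancel_left _ _ hd]
  rw [this, trace_mul_comm, ← mul_assoc, mul_nonsing_inv _ hd, one_mul, trace_transpose]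

theorem isBivector_oddPart {g Λ : Mat4} (hΛ : Λ ∈ properLorentz g) :
    IsBivector g (oddPart Λ) := by
  rw [isBivector_iff, oddPart, transpose_smul, Matrix.smul_mul, transpose_sub, sub_mul,
    transpose_mul_of_mem hΛ, inv_transpose_mul_of_mem hΛ, Matrix.mul_smul, mul_sub, ← smul_neg,
    neg_sub]

theorem evenPart_selfAdjoint {g Λ : Mat4} (hΛ : Λ ∈ properLorentz g) :
    (evenPart Λ)ᵀ * g = g * evenPart Λ := by
  rw [evenPart, transpose_smul, Matrix.smul_mul, transpose_add, add_mul,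
    transpose_mul_of_mem hΛ, inv_transpose_mul_of_mem hΛ, Matrix.mul_smul, mul_add, add_comm]

theorem evenPart_mul_oddPart {g Λ : Mat4} (hΛ : Λ ∈ properLorentz g) :
    evenPart Λ * oddPart Λ = oddPart Λ * evenPart Λ := by
  simp only [evenPart, oddPart, Matrix.smul_mul, Matrix.mul_smul, add_mul, mul_add, sub_mul,
    mul_sub, mul_inv_of_mem hΛ, inv_mul_of_mem hΛ]
  module

theorem oddPart_sq {g Λ : Mat4} (hΛ : Λ ∈ properLorentz g) :
    oddPart Λ * oddPart Λ = evenPart Λ * evenPart Λ - 1 := by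
  simp only [evenPart, oddPart, Matrix.smul_mul, Matrix.mul_smul, add_mul, mul_add, sub_mul,
    mul_sub, mul_inv_of_mem hΛ, inv_mul_of_mem hΛ]
  module

theorem trace_evenPart {g Λ : Mat4} (hd : IsUnit g.det) (hΛ : Λ ∈ properLorentz g) :
    (evenPart Λ).trace = Λ.trace := by
  rw [evenPart, trace_smul, trace_add, trace_inv_of_mem hd hΛ, smul_eq_mul]
  ring

theorem evenPart_quadratic {g Λ : Mat4} (hd : IsUnit g.det) (hΛ : Λ ∈ properLorentz g) :
    evenPart Λ * evenPart Λ = (Λ.trace / 2) • evenPart Λ -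
      ((genTrace 2 Λ - 2) / 4) • (1 : Mat4) := by
  have hch := cayleyHamilton Λ
  rw [thirdTrace_eq_trace (mul_inv_of_mem hΛ) hΛ.2, trace_inv_of_mem hd hΛ, hΛ.2, one_smul] at hch
  -- Dividing the palindromic quartic by `Λ²` leaves a quadratic relation in `Λ + Λ⁻¹`.
  have h : Λ⁻¹ * (Λ ^ 4 - Λ.trace • Λ ^ 3 + genTrace 2 Λ • Λ ^ 2 - Λ.trace • Λ + 1) * Λ⁻¹ = 0 := by
    rw [hch, mul_zero, zero_mul]
  have e2 : Λ⁻¹ * Λ ^ 2 * Λ⁻¹ = 1 := by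
    rw [pow_two, ← mul_assoc, inv_mul_of_mem hΛ, one_mul, mul_inv_of_mem hΛ]
  have e3 : Λ⁻¹ * Λ ^ 3 * Λ⁻¹ = Λ := by
    rw [pow_succ', ← mul_assoc, inv_mul_of_mem hΛ, one_mul, pow_two, mul_assoc, mul_inv_of_mem hΛ,
      mul_one]
  have e4 : Λ⁻¹ * Λ ^ 4 * Λ⁻¹ = Λ * Λ := by
    rw [pow_succ', ← mul_assoc, inv_mul_of_mem hΛ, one_mul, pow_succ', mul_assoc, pow_two,
      mul_assoc Λ, mul_inv_of_mem hΛ, mul_one]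
  have e1 : Λ⁻¹ * Λ * Λ⁻¹ = Λ⁻¹ := by rw [inv_mul_of_mem hΛ, one_mul]
  simp only [mul_add, mul_sub, add_mul, sub_mul, Matrix.mul_smul, Matrix.smul_mul, e1, e2, e3, e4,
    mul_one] at h
  simp only [evenPart, Matrix.smul_mul, Matrix.mul_smul, add_mul, mul_add,
    mul_inv_of_mem hΛ, inv_mul_of_mem hΛ]
  have h' : Λ * Λ + Λ⁻¹ * Λ⁻¹ = Λ.trace • Λ + Λ.trace • Λ⁻¹ - genTrace 2 Λ • (1 : Mat4) := by
    rw [← sub_eq_zero, ← h]; abel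
  calc _ = (1 / 4 : ℝ) • (Λ * Λ + Λ⁻¹ * Λ⁻¹) + (1 / 2 : ℝ) • (1 : Mat4) := by module
    _ = _ := by rw [h']; module

theorem det_oddPart {g Λ : Mat4} (hd : IsUnit g.det) (hΛ : Λ ∈ properLorentz g) :
    (oddPart Λ).det = ((genTrace 2 Λ + 2) ^ 2 - 4 * Λ.trace ^ 2) / 16 := by
  -- The factorisation `½ Λ⁻¹ (Λ - 1)(Λ + 1)` reduces the determinant to characteristic polynomial
  -- values at `±1`.
  have h1 : oddPart Λ = (1 / 2 : ℝ) •
      (Λ⁻¹ * (((-1 : ℝ) • (1 : Mat4) + (1 : ℝ) • Λ) * ((1 : ℝ) • (1 : Mat4) + (1 : ℝ) • Λ))) := by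
    rw [oddPart]
    congr 1
    simp only [one_smul, neg_one_smul, mul_add, add_mul, mul_one, one_mul, mul_neg, neg_mul,
      ← mul_assoc, inv_mul_of_mem hΛ]
    abel
  have h2 : (Λ⁻¹).det = 1 := by
    have := congrArg det (mul_inv_of_mem hΛ)
    rwa [det_mul, hΛ.2, one_mul, det_one] at this
  rw [h1, det_smul, det_mul, det_mul, h2, det_smul_add_smul, det_smul_add_smul, ← genTrace_two,
    thirdTrace_eq_trace (mul_inv_of_mem hΛ) hΛ.2, trace_inv_of_mem hd hΛ, hΛ.2]
  simp
  ring

/-! ### Spectral projections and bounds on the eigenvalues. -/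

/-- The spectral projection of `A` for the eigenvalue `p`, when the only other eigenvalue is `q`. -/
def specProj (A : Mat4) (p q : ℝ) : Mat4 := (p - q)⁻¹ • (A - q • (1 : Mat4))

section specProj

variable {A : Mat4} {p q : ℝ}

theorem specProj_add_specProj (hpq : p ≠ q) : specProj A p q + specProj A q p = 1 := by
  have h : (p - q) ≠ 0 := sub_ne_zero.2 hpq
  rw [specProj, specProj, ← neg_sub p q, inv_neg, neg_smul, ← sub_eq_add_neg, ← smul_sub,
    show A - q • (1 : Mat4) - (A - p • (1 : Mat4)) = (p - q) • (1 : Mat4) by module,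
    inv_smul_smul₀ h]

theorem mul_specProj (hA : A * A = (p + q) • A - (p * q) • (1 : Mat4)) :
    A * specProj A p q = p • specProj A p q := by
  rw [specProj, Matrix.mul_smul, mul_sub, hA, Matrix.mul_smul, mul_one]
  module

theorem specProj_comm {B : Mat4} (h : A * B = B * A) :
    specProj A p q * B = B * specProj A p q := by
  simp only [specProj, Matrix.mul_smul, Matrix.smul_mul, mul_sub, sub_mul, h, mul_one, one_mul]

theorem specProj_mul_self (hpq : p ≠ q) (hA : A * A = (p + q) • A - (p * q) • (1 : Mat4)) :
    specProj A p q * specProj A p q = specProj A p q := by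
  have h : (p - q) ≠ 0 := sub_ne_zero.2 hpq
  nth_rw 1 [specProj]
  rw [Matrix.smul_mul, sub_mul, mul_specProj hA, Matrix.smul_mul, one_mul, ← sub_smul,
    inv_smul_smul₀ h]

theorem specProj_mul_specProj (hA : A * A = (p + q) • A - (p * q) • (1 : Mat4)) :
    specProj A q p * specProj A p q = 0 := by
  nth_rw 1 [specProj]
  rw [Matrix.smul_mul, sub_mul, mul_specProj hA, Matrix.smul_mul, one_mul, sub_self, smul_zero]

theorem eq_smul_specProj_add (hpq : p ≠ q) : A = p • specProj A p q + q • specProj A q p := by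
  have h : (p - q) ≠ 0 := sub_ne_zero.2 hpq
  rw [specProj, specProj, ← neg_sub p q, inv_neg, neg_smul, smul_neg, ← sub_eq_add_neg,
    smul_comm p, smul_comm q, ← smul_sub,
    show p • (A - q • (1 : Mat4)) - q • (A - p • (1 : Mat4)) = (p - q) • A by module,
    inv_smul_smul₀ h]

theorem trace_specProj (hpq : p ≠ q) (hA : A.trace = 2 * (p + q)) :
    (specProj A p q).trace = 2 := by
  have h : (p - q) ≠ 0 := sub_ne_zero.2 hpq
  rw [specProj, trace_smul, trace_sub, hA, trace_smul, trace_one, smul_eq_mul, smul_eq_mul,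
    Fintype.card_fin]
  field_simp
  push_cast
  ring

theorem specProj_selfAdjoint {g : Mat4} (h : Aᵀ * g = g * A) :
    (specProj A p q)ᵀ * g = g * specProj A p q := by
  rw [specProj, transpose_smul, transpose_sub, transpose_smul, transpose_one, Matrix.smul_mul,
    sub_mul, h, Matrix.mul_smul, mul_sub, Matrix.smul_mul, Matrix.mul_smul, mul_one, one_mul]

theorem mulVec_of_specProj_mulVec (hA : A * A = (p + q) • A - (p * q) • (1 : Mat4))
    {v : Fin 4 → ℝ} (hv : specProj A p q *ᵥ v = v) : A *ᵥ v = p • v := by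
  rw [← hv, mulVec_mulVec, mul_specProj hA, smul_mulVec]

theorem specProj_ne_zero (hpq : p ≠ q) (ht : A.trace = 2 * (p + q)) :
    specProj A p q ≠ 0 := by
  intro h0
  have := trace_specProj hpq ht
  simp [h0] at this

end specProj

theorem form_mulVec_of_selfAdjoint {g M : Mat4} (h : Mᵀ * g = g * M) (u v : Fin 4 → ℝ) :
    form g (M *ᵥ u) v = form g u (M *ᵥ v) := by
  rw [form_mulVec_left, h, form_mulVec_right]

/-- The algebraic relations between the even part `A` and the odd part `B` of an orthochronous
Lorentz transformation, where `p` and `q` are the eigenvalues of `A`. -/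
structure IsEvenOddPair (g A B : Mat4) (p q : ℝ) : Prop where
  symm : g.IsSymm
  unit : IsUnit g.det
  mostlyPlus : IsMostlyPlus g
  selfAdjoint : Aᵀ * g = g * A
  bivector : IsBivector g B
  comm : A * B = B * A
  sq : B * B = A * A - 1
  quadratic : A * A = (p + q) • A - (p * q) • (1 : Mat4)
  trace_eq : A.trace = 2 * (p + q)
  form_neg : ∀ v, form g v v < 0 → form g v (A *ᵥ v) < 0
  -- For the even and odd parts of `Λ`, the left side is `det B`.
  mul_nonpos : (1 - p ^ 2) * (1 - q ^ 2) ≤ 0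
  le : q ≤ p

namespace IsEvenOddPair

variable {g A B : Mat4} {p q : ℝ} (h : IsEvenOddPair g A B p q)

include h

theorem quadratic' : A * A = (q + p) • A - (q * p) • (1 : Mat4) := by
  rw [h.quadratic, add_comm p, mul_comm p]

theorem form_odd_odd {r : ℝ} {v : Fin 4 → ℝ} (hv : A *ᵥ v = r • v) :
    form g (B *ᵥ v) (B *ᵥ v) = -((r ^ 2 - 1) * form g v v) := by
  rw [h.bivector.form_mulVec, mulVec_mulVec, h.sq, sub_mulVec, ← mulVec_mulVec, hv, mulVec_smul,
    hv, one_mulVec, form_sub_right, form_smul_right, form_smul_right]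
  ring

theorem form_odd_self (v : Fin 4 → ℝ) : form g v (B *ᵥ v) = 0 := by
  have := h.bivector.form_mulVec v v
  rw [form_comm h.symm] at this
  linarith

/-- Time orientation gives `r > 0`. As `B v` is orthogonal to `v`, its square `-(r² - 1) g(v, v)` is
nonnegative, so `r² ≥ 1`. -/
theorem one_le_of_timelike {r : ℝ} {v : Fin 4 → ℝ} (hv : A *ᵥ v = r • v) (ht : form g v v < 0) :
    1 ≤ r := by
  have h1 := h.form_neg v ht
  rw [hv, form_smul_right] at h1
  have h2 := h.mostlyPlus.nonneg_of_orthogonal h.symm ht (h.form_odd_self v)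
  rw [h.form_odd_odd hv] at h2
  have h3 : 0 < r := by
    by_contra! hc
    nlinarith [mul_nonneg (neg_nonneg.2 hc) (neg_nonneg.2 ht.le)]
  by_contra! hc
  nlinarith [mul_pos (show 0 < 1 - r ^ 2 by nlinarith) (neg_pos.2 ht)]

theorem form_specProj_specProj (u v : Fin 4 → ℝ) :
    form g (specProj A p q *ᵥ u) (specProj A q p *ᵥ v) = 0 := by
  rw [form_mulVec_of_selfAdjoint (specProj_selfAdjoint h.selfAdjoint), mulVec_mulVec,
    specProj_mul_specProj h.quadratic', zero_mulVec, form_comm h.symm, form_zero_left]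

/-- The two eigenspaces are orthogonal, so one of the components of a timelike vector is timelike.
-/
theorem exists_timelike (hpq : q ≠ p) :
    (∃ v, form g v v < 0 ∧ specProj A p q *ᵥ v = v) ∨
      ∃ v, form g v v < 0 ∧ specProj A q p *ᵥ v = v := by
  obtain ⟨e, he, -⟩ := id h.mostlyPlus
  have h1 : e = specProj A p q *ᵥ e + specProj A q p *ᵥ e := by
    rw [← add_mulVec, specProj_add_specProj hpq.symm, one_mulVec]
  rw [h1, form_add_left, form_add_right, form_add_right, h.form_specProj_specProj,
    form_comm h.symm (specProj A q p *ᵥ e), h.form_specProj_specProj] at he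
  by_cases h2 : form g (specProj A p q *ᵥ e) (specProj A p q *ᵥ e) < 0
  · exact Or.inl ⟨_, h2, by rw [mulVec_mulVec, specProj_mul_self hpq.symm h.quadratic]⟩
  · exact Or.inr ⟨_, by linarith, by rw [mulVec_mulVec, specProj_mul_self hpq h.quadratic']⟩

theorem trace_eq' : A.trace = 2 * (q + p) := by rw [h.trace_eq, add_comm]

theorem spacelike {v w : Fin 4 → ℝ} (hv : form g v v < 0) (hPv : specProj A p q *ᵥ v = v)
    (hw : w ≠ 0) (hQw : specProj A q p *ᵥ w = w) : 0 < form g w w := by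
  refine h.mostlyPlus.pos_of_orthogonal h.symm hv hw ?_
  rw [← hPv, ← hQw, h.form_specProj_specProj]

theorem bounds_of_ne (hpq : q ≠ p) : 1 ≤ p ∧ -1 ≤ q ∧ q ≤ 1 := by
  have hlt : q < p := lt_of_le_of_ne h.le hpq
  have hm := h.mul_nonpos
  rcases h.exists_timelike hpq with ⟨v, hv, hPv⟩ | ⟨v, hv, hQv⟩
  · have hp := h.one_le_of_timelike (mulVec_of_specProj_mulVec h.quadratic hPv) hv
    refine ⟨hp, ?_⟩
    rcases hp.eq_or_lt with hp1 | hp1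
    -- At `p = 1` the sign of the product says nothing about `q`. Instead `B` maps a spacelike
    -- `q`-eigenvector `w` into `v`'s orthogonal complement, so `g(B w, B w) ≥ 0` excludes `q < -1`.
    · refine ⟨?_, by linarith⟩
      by_contra! hc
      obtain ⟨i, hi⟩ : ∃ i, specProj A q p *ᵥ Pi.single i 1 ≠ 0 := by
        by_contra! hc
        exact specProj_ne_zero hpq h.trace_eq' (Matrix.ext_of_mulVec_single fun i => by
          rw [hc, zero_mulVec])
      set w := specProj A q p *ᵥ Pi.single i 1 with hw
      have hQw : specProj A q p *ᵥ w = w := by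
        rw [hw, mulVec_mulVec, specProj_mul_self hpq h.quadratic']
      have h1 := h.spacelike hv hPv hi hQw
      have hBw : form g v (B *ᵥ w) = 0 := by
        rw [← hPv, ← hQw, mulVec_mulVec, ← specProj_comm h.comm, ← mulVec_mulVec,
          h.form_specProj_specProj]
      have h2 := h.mostlyPlus.nonneg_of_orthogonal h.symm hv hBw
      rw [h.form_odd_odd (mulVec_of_specProj_mulVec h.quadratic' hQw)] at h2
      nlinarith [mul_pos (show 0 < q ^ 2 - 1 by nlinarith) h1]
    · have : q ^ 2 ≤ 1 := by
        by_contra! hc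
        nlinarith [mul_pos (show 0 < p ^ 2 - 1 by nlinarith) (show 0 < q ^ 2 - 1 by linarith)]
      exact abs_le.1 ((sq_le_one_iff_abs_le_one q).1 this)
  · have hq := h.one_le_of_timelike (mulVec_of_specProj_mulVec h.quadratic' hQv) hv
    refine ⟨by linarith, by linarith, ?_⟩
    by_contra! hc
    nlinarith [mul_pos (show 0 < p ^ 2 - 1 by nlinarith) (show 0 < q ^ 2 - 1 by nlinarith)]

theorem eq_one_of_eq (hpq : q = p) : p = 1 := by
  subst hpq
  have hm := h.mul_nonpos
  have h1 : 1 - q ^ 2 = 0 := by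
    have : (1 - q ^ 2) ^ 2 = 0 := le_antisymm (by rwa [_root_.sq]) (sq_nonneg _)
    exact pow_eq_zero_iff two_ne_zero |>.1 this
  have h2 : (q - 1) * (q + 1) = 0 := by linarith
  rcases mul_eq_zero.1 h2 with h2 | h2
  · linarith
  exfalso
  have hq : q = -1 := by linarith
  have hA := h.quadratic
  rw [hq] at hA
  obtain ⟨v, hv, -⟩ := id h.mostlyPlus
  -- To exclude `q = -1`: `w` is null with `A w = -w`, so `v + w` is timelike while `A (v + w) = -v`
  -- reverses its time orientation.
  obtain ⟨w, hw⟩ : ∃ w, w = A *ᵥ v + v := ⟨_, rfl⟩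
  have hAw : A *ᵥ w = -w := by
    rw [hw, mulVec_add, mulVec_mulVec, hA, sub_mulVec, smul_mulVec, smul_mulVec, one_mulVec]
    module
  have hAv : A *ᵥ v = w - v := by rw [hw]; abel
  have e1 : form g v w = form g v (A *ᵥ v) + form g v v := by rw [hw, form_add_right]
  have e2 : form g w w = 0 := by
    have := form_mulVec_of_selfAdjoint h.selfAdjoint v w
    rw [hAw, hAv, form_sub_left, ← neg_one_smul ℝ, form_smul_right] at this
    linarith
  have h3 := h.form_neg v hv
  have h4 : form g (v + w) (v + w) = form g v v + 2 * form g v w := by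
    rw [form_add_left, form_add_right, form_add_right, e2, form_comm h.symm w v]; ring
  have h5 := h.form_neg (v + w) (by rw [h4]; linarith)
  rw [mulVec_add, hAw, hAv, show w - v + -w = -v by abel, form_add_left,
    ← neg_one_smul ℝ, form_smul_right, form_smul_right, form_comm h.symm w v] at h5
  linarith

theorem bounds : 1 ≤ p ∧ -1 ≤ q ∧ q ≤ 1 := by
  by_cases hpq : q = p
  · have := h.eq_one_of_eq hpq
    exact ⟨this.ge, by linarith, by linarith⟩
  · exact h.bounds_of_ne hpq

end IsEvenOddPair

/-! ### Boost and rotation generators; construction of logarithms. -/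

theorem eq_zero_of_idempotent_of_trace {R : Mat4} (hR : R * R = R) (ht : R.trace = 0) : R = 0 := by
  have h1 : IsIdempotentElem (Matrix.toLin' R) := by
    rw [IsIdempotentElem, Module.End.mul_eq_comp, ← toLin'_mul, hR]
  have h2 := LinearMap.IsIdempotentElem.eq_zero_of_trace_eq_zero h1 (by rw [trace_toLin'_eq, ht])
  exact (Matrix.toLin').map_eq_zero_iff.1 h2

/-- `w ↦ g(v, w) u` as a matrix. -/
def dyad (g : Mat4) (u v : Fin 4 → ℝ) : Mat4 := vecMulVec u v * g

theorem dyad_mulVec (g : Mat4) (u v w : Fin 4 → ℝ) : dyad g u v *ᵥ w = form g v w • u := by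
  rw [dyad, ← mulVec_mulVec, vecMulVec_mulVec, form]
  simp

theorem mul_dyad (g M : Mat4) (u v : Fin 4 → ℝ) : M * dyad g u v = dyad g (M *ᵥ u) v := by
  rw [dyad, dyad, ← mul_assoc, mul_vecMulVec]

theorem dyad_mul {g M : Mat4} (hM : Mᵀ * g = g * M) (u v : Fin 4 → ℝ) :
    dyad g u v * M = dyad g u (M *ᵥ v) := by
  rw [dyad, dyad, mul_assoc, ← hM, ← mul_assoc, vecMulVec_mul, vecMul_transpose]

theorem dyad_mul_dyad (g : Mat4) (u v w x : Fin 4 → ℝ) :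
    dyad g u v * dyad g w x = form g v w • dyad g u x := by
  rw [mul_dyad, dyad_mulVec, dyad, dyad, smul_vecMulVec, Matrix.smul_mul]

theorem trace_dyad {g : Mat4} (hs : g.IsSymm) (u v : Fin 4 → ℝ) :
    (dyad g u v).trace = form g u v := by
  rw [dyad, vecMulVec_mul, trace_vecMulVec, form, ← vecMul_transpose, hs.eq]

theorem dyad_selfAdjoint {g : Mat4} (hs : g.IsSymm) (u : Fin 4 → ℝ) :
    (dyad g u u)ᵀ * g = g * dyad g u u := by
  rw [dyad, transpose_mul, transpose_vecMulVec, hs.eq, mul_assoc]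

/-- One Gram–Schmidt step: splitting a unit vector off a spacelike image leaves an orthogonal
projection of trace one less. -/
theorem exists_unit_of_idempotent {g R : Mat4} (hs : g.IsSymm) (hR : R * R = R)
    (hadj : Rᵀ * g = g * R) (ht : R.trace ≠ 0)
    (hpos : ∀ w, w ≠ 0 → R *ᵥ w = w → 0 < form g w w) :
    ∃ u, R *ᵥ u = u ∧ form g u u = 1 ∧
      (R - dyad g u u) * (R - dyad g u u) = R - dyad g u u ∧
      (R - dyad g u u)ᵀ * g = g * (R - dyad g u u) ∧
      (R - dyad g u u).trace = R.trace - 1 ∧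
      ∀ w, (R - dyad g u u) *ᵥ w = w → R *ᵥ w = w ∧ form g u w = 0 := by
  obtain ⟨i, hi⟩ : ∃ i, R *ᵥ Pi.single i 1 ≠ 0 := by
    by_contra! hc
    have hR0 : R = 0 := Matrix.ext_of_mulVec_single fun i => by rw [hc, zero_mulVec]
    exact ht (by rw [hR0, trace_zero])
  obtain ⟨w, hw⟩ : ∃ w, w = R *ᵥ Pi.single i 1 := ⟨_, rfl⟩
  rw [← hw] at hi
  have hRw : R *ᵥ w = w := by rw [hw, mulVec_mulVec, hR]
  have hww := hpos w hi hRw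
  obtain ⟨u, hu⟩ : ∃ u, u = (√(form g w w))⁻¹ • w := ⟨_, rfl⟩
  have hRu : R *ᵥ u = u := by rw [hu, mulVec_smul, hRw]
  have huu : form g u u = 1 := by
    rw [hu, form_smul_left, form_smul_right, ← mul_assoc, ← mul_inv, Real.mul_self_sqrt hww.le,
      inv_mul_cancel₀ hww.ne']
  have hidem : (R - dyad g u u) * (R - dyad g u u) = R - dyad g u u := by
    rw [sub_mul, mul_sub, mul_sub, hR, mul_dyad, dyad_mul hadj, dyad_mul_dyad, hRu, huu, one_smul,
      sub_self, sub_zero]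
  have hself : (R - dyad g u u)ᵀ * g = g * (R - dyad g u u) := by
    rw [transpose_sub, sub_mul, hadj, dyad_selfAdjoint hs, mul_sub]
  have hu0 : (R - dyad g u u) *ᵥ u = 0 := by
    rw [sub_mulVec, hRu, dyad_mulVec, huu, one_smul, sub_self]
  refine ⟨u, hRu, huu, hidem, hself, by rw [trace_sub, trace_dyad hs, huu], fun x hx => ⟨?_, ?_⟩⟩
  · rw [← hx, mulVec_mulVec, mul_sub, hR, mul_dyad, hRu]
  · rw [← hx, ← form_mulVec_of_selfAdjoint hself, hu0, form_zero_left]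

/-- Two Gram–Schmidt steps exhaust the trace, giving an orthonormal basis `u, v` of the plane; `J`
is its wedge. This serves the half turn `q = -1`, where `B` vanishes on the plane and cannot supply
`J`. -/
theorem exists_rotation_generator {g Q : Mat4} (hs : g.IsSymm) (hQ : Q * Q = Q)
    (hadj : Qᵀ * g = g * Q) (ht : Q.trace = 2)
    (hpos : ∀ w, w ≠ 0 → Q *ᵥ w = w → 0 < form g w w) :
    ∃ J, IsBivector g J ∧ Q * J = J ∧ J * Q = J ∧ J * J = -Q := by
  obtain ⟨u, hu, huu, h1, h2, h3, h4⟩ := exists_unit_of_idempotent hs hQ hadj (by simp [ht]) hpos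
  obtain ⟨v, hv, hvv, h5, -, h6, -⟩ := exists_unit_of_idempotent hs h1 h2 (by norm_num [h3, ht])
    fun w hw hRw => hpos w hw (h4 w hRw).1
  obtain ⟨hQv, huv⟩ := h4 v hv
  have h7 := eq_zero_of_idempotent_of_trace h5 (by rw [h6, h3, ht]; norm_num)
  have hQ' : Q = dyad g u u + dyad g v v := by
    rw [sub_sub, sub_eq_zero] at h7
    exact h7
  have hw : wedge g u v = dyad g u v - dyad g v u := rfl
  refine ⟨wedge g u v, isBivector_wedge hs u v, ?_, ?_, ?_⟩
  · rw [hw, mul_sub, mul_dyad, mul_dyad, hu, hQv]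
  · rw [hw, sub_mul, dyad_mul hadj, dyad_mul hadj, hu, hQv]
  · simp only [hw, sub_mul, mul_sub, dyad_mul_dyad, huu, hvv, huv, form_comm hs v u]
    rw [hQ']
    module

theorem IsBivector.mul_of_selfAdjoint {g P B : Mat4} (hB : IsBivector g B)
    (hP : Pᵀ * g = g * P) (hc : P * B = B * P) : IsBivector g (P * B) := by
  rw [isBivector_iff] at *
  rw [hc, transpose_mul, mul_assoc, hB, mul_neg, ← mul_assoc, hP, mul_assoc, hc]

theorem add_eq_specProj {A B : Mat4} {p q : ℝ} (hqp : q < p) : A + B =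
    p • specProj A p q + specProj A p q * B + q • specProj A q p + specProj A q p * B := by
  have h1 := specProj_add_specProj (A := A) hqp.ne'
  have h2 := eq_smul_specProj_add (A := A) hqp.ne'
  calc A + B = (p • specProj A p q + q • specProj A q p) +
        (specProj A p q + specProj A q p) * B := by rw [← h2, h1, one_mul]
    _ = _ := by rw [add_mul]; abel

namespace IsEvenOddPair

variable {g A B : Mat4} {p q : ℝ} (h : IsEvenOddPair g A B p q)

include h

theorem specProj_mul_odd_sq {r s : ℝ} (hrs : r ≠ s)
    (hA : A * A = (r + s) • A - (r * s) • (1 : Mat4)) :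
    (specProj A r s * B) * (specProj A r s * B) = (r ^ 2 - 1) • specProj A r s := by
  have hc := specProj_comm (p := r) (q := s) h.comm
  have hc' := specProj_comm (p := r) (q := s) (B := A) rfl
  calc _ = specProj A r s * (B * specProj A r s) * B := by noncomm_ring
    _ = specProj A r s * specProj A r s * (B * B) := by rw [← hc]; noncomm_ring
    _ = specProj A r s * A * A - specProj A r s := by
      rw [specProj_mul_self hrs hA, h.sq]; noncomm_ring
    _ = _ := by
      rw [hc', mul_specProj hA, Matrix.smul_mul, hc', mul_specProj hA]
      module

theorem isBivector_specProj_mul_odd (r s : ℝ) : IsBivector g (specProj A r s * B) :=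
  h.bivector.mul_of_selfAdjoint (specProj_selfAdjoint h.selfAdjoint) (specProj_comm h.comm)

theorem specProj_mul_odd_eq_zero {r s : ℝ} (hrs : r ≠ s)
    (hA : A * A = (r + s) • A - (r * s) • (1 : Mat4)) (hr : r ^ 2 = 1) :
    specProj A r s * B = 0 :=
  (h.isBivector_specProj_mul_odd r s).eq_zero_of_sq h.symm h.mostlyPlus
    (by rw [h.specProj_mul_odd_sq hrs hA, hr, sub_self, zero_smul])

theorem exists_boost_generator (hqp : q < p) (hp : 1 < p) :
    ∃ K, IsBivector g K ∧ specProj A p q * K = K ∧ K * specProj A p q = K ∧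
      K * K = specProj A p q ∧ specProj A p q * B = Real.sinh (Real.arcosh p) • K := by
  have hsq : 0 < p ^ 2 - 1 := by nlinarith
  have hs : Real.sinh (Real.arcosh p) = √(p ^ 2 - 1) := Real.sinh_arcosh hp.le
  have hs0 : 0 < √(p ^ 2 - 1) := Real.sqrt_pos.2 hsq
  rw [hs]
  refine ⟨(√(p ^ 2 - 1))⁻¹ • (specProj A p q * B), (h.isBivector_specProj_mul_odd p q).smul _,
    ?_, ?_, ?_, ?_⟩
  · rw [Matrix.mul_smul, ← mul_assoc, specProj_mul_self hqp.ne' h.quadratic]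
  · rw [Matrix.smul_mul, mul_assoc, ← specProj_comm h.comm, ← mul_assoc,
      specProj_mul_self hqp.ne' h.quadratic]
  · rw [Matrix.smul_mul, Matrix.mul_smul, h.specProj_mul_odd_sq hqp.ne' h.quadratic, smul_smul,
      smul_smul, ← mul_inv, Real.mul_self_sqrt hsq.le, inv_mul_cancel₀ hsq.ne', one_smul]
  · rw [smul_inv_smul₀ hs0.ne']

theorem exists_rotation_generator (hqp : q < p) (hq : q < 1) :
    ∃ J, IsBivector g J ∧ specProj A q p * J = J ∧ J * specProj A q p = J ∧
      J * J = -specProj A q p ∧ specProj A q p * B = Real.sin (Real.arccos q) • J := by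
  obtain ⟨-, hq1, -⟩ := h.bounds
  rw [Real.sin_arccos]
  rcases hq1.eq_or_lt with hq1 | hq1
  · have h0 := h.specProj_mul_odd_eq_zero hqp.ne h.quadratic' (by rw [← hq1]; norm_num)
    rcases h.exists_timelike hqp.ne with ⟨v, hv, hPv⟩ | ⟨v, hv, hQv⟩
    · obtain ⟨J, hJ, h1, h2, h3⟩ := LorentzBivector.exists_rotation_generator h.symm
        (specProj_mul_self hqp.ne h.quadratic') (specProj_selfAdjoint h.selfAdjoint)
        (trace_specProj hqp.ne h.trace_eq') fun w hw hQw => h.spacelike hv hPv hw hQw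
      refine ⟨J, hJ, h1, h2, h3, ?_⟩
      rw [h0, ← hq1]
      norm_num
    · have := h.one_le_of_timelike (mulVec_of_specProj_mulVec h.quadratic' hQv) hv
      linarith
  · have hsq : 0 < 1 - q ^ 2 := by nlinarith
    have hs0 : 0 < √(1 - q ^ 2) := Real.sqrt_pos.2 hsq
    refine ⟨(√(1 - q ^ 2))⁻¹ • (specProj A q p * B), (h.isBivector_specProj_mul_odd q p).smul _,
      ?_, ?_, ?_, ?_⟩
    · rw [Matrix.mul_smul, ← mul_assoc, specProj_mul_self hqp.ne h.quadratic']
    · rw [Matrix.smul_mul, mul_assoc, ← specProj_comm h.comm, ← mul_assoc,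
        specProj_mul_self hqp.ne h.quadratic']
    · rw [Matrix.smul_mul, Matrix.mul_smul, h.specProj_mul_odd_sq hqp.ne h.quadratic', smul_smul,
        smul_smul, ← mul_inv, Real.mul_self_sqrt hsq.le, ← neg_sub 1 (q ^ 2), mul_neg,
        inv_mul_cancel₀ hsq.ne', neg_one_smul]
    · rw [smul_inv_smul₀ hs0.ne']

theorem isSimple_of_mul_eq_zero {L R : Mat4} (hL : IsBivector g L) (hR : R ≠ 0)
    (hLR : L * R = 0) : IsSimpleBivector g L := by
  refine hL.isSimple h.symm h.unit ?_
  by_contra hdet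
  exact hR (by
    rw [← nonsing_inv_mul_cancel_left L R (isUnit_iff_ne_zero.2 hdet), hLR, mul_zero])

/-- Here `p = q = 1`, so `B² = 2(A - 1)` and `B⁴ = 0`. The bivector `B³` squares to zero and hence
vanishes, so `exp B = 1 + B + ½B² = A + B`. -/
theorem isSimpleLorentz_of_eq (hqp : q = p) : IsSimpleLorentz g (A + B) := by
  have hp := h.eq_one_of_eq hqp
  have hA := h.quadratic
  have hB := h.sq
  rw [hqp, hp] at hA
  have hBB : B * B = (2 : ℝ) • (A - 1) := by rw [hB, hA]; module
  have hAA : (A - 1) * (A - 1) = 0 := by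
    simp only [sub_mul, mul_sub, hA, one_mul, mul_one]; module
  have hB4 : (B * B) * (B * B) = 0 := by
    rw [hBB, Matrix.smul_mul, Matrix.mul_smul, hAA, smul_zero, smul_zero]
  have hself : (B * B)ᵀ * g = g * (B * B) := by
    have := isBivector_iff.1 h.bivector
    rw [transpose_mul, mul_assoc, this, mul_neg, ← mul_assoc, this, neg_mul, neg_neg, mul_assoc]
  have hB3 : B * (B * B) = 0 := by
    rw [← mul_assoc]
    refine (h.bivector.mul_of_selfAdjoint hself (mul_assoc _ _ _)).eq_zero_of_sq h.symm
      h.mostlyPlus ?_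
    calc _ = ((B * B) * (B * B)) * (B * B) := by noncomm_ring
      _ = 0 := by rw [hB4, zero_mul]
  have hdet : B.det = 0 := by
    have := congrArg det hB3
    rw [det_mul, det_mul, det_zero] at this
    simpa using this
  refine ⟨B, h.bivector.isSimple h.symm h.unit hdet, ?_⟩
  rw [exp_eq_of_cube_eq_zero hB3, hBB]
  module

theorem isSimpleLorentz_of_left (hqp : q < p) (hp : p = 1) : IsSimpleLorentz g (A + B) := by
  obtain ⟨J, hJ, hQJ, hJQ, hJJ, hJB⟩ := h.exists_rotation_generator hqp (hp ▸ hqp)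
  have hPB := h.specProj_mul_odd_eq_zero hqp.ne' h.quadratic (by rw [hp]; norm_num)
  have hJP : J * specProj A p q = 0 := by
    rw [← hJQ, mul_assoc, specProj_mul_specProj h.quadratic, mul_zero]
  refine ⟨Real.arccos q • J, h.isSimple_of_mul_eq_zero (hJ.smul _)
    (specProj_ne_zero hqp.ne' h.trace_eq) (by rw [Matrix.smul_mul, hJP, smul_zero]), ?_⟩
  rw [exp_eq_of_blocks (P := specProj A p q) (Q := specProj A q p) (K := 0) (J := J) (a := 0)
    (b := Real.arccos q), Real.cos_arccos h.bounds.2.1 h.bounds.2.2, add_eq_specProj hqp, hPB, hJB,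
    Real.cosh_zero, hp, smul_zero]
  · rw [Matrix.smul_mul, hJP, smul_zero, smul_zero]
  · rw [mul_zero, zero_smul]
  · rw [Matrix.smul_mul, hJQ]
  · rw [Matrix.smul_mul, hJJ, smul_neg]
  · exact specProj_add_specProj hqp.ne'

theorem isSimpleLorentz_of_right (hqp : q < p) (hq : q = 1) : IsSimpleLorentz g (A + B) := by
  obtain ⟨K, hK, hPK, hKP, hKK, hKB⟩ := h.exists_boost_generator hqp (hq ▸ hqp)
  have hQB := h.specProj_mul_odd_eq_zero hqp.ne h.quadratic' (by rw [hq]; norm_num)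
  have hKQ : K * specProj A q p = 0 := by
    rw [← hKP, mul_assoc, specProj_mul_specProj h.quadratic', mul_zero]
  refine ⟨Real.arcosh p • K, h.isSimple_of_mul_eq_zero (hK.smul _)
    (specProj_ne_zero hqp.ne h.trace_eq') (by rw [Matrix.smul_mul, hKQ, smul_zero]), ?_⟩
  rw [exp_eq_of_blocks (P := specProj A p q) (Q := specProj A q p) (K := K) (J := 0)
    (a := Real.arcosh p) (b := 0), Real.cosh_arcosh h.bounds.1, add_eq_specProj hqp, hQB, hKB,
    Real.cos_zero, hq, smul_zero]
  · rw [Matrix.smul_mul, hKP]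
  · rw [Matrix.smul_mul, hKK]
  · rw [Matrix.smul_mul, hKQ, smul_zero, smul_zero]
  · rw [mul_zero, zero_smul, neg_zero]
  · exact specProj_add_specProj hqp.ne'

theorem exists_log (hqp : q < p) (hp : 1 < p) (hq : q < 1) :
    ∃ L, IsBivector g L ∧ NormedSpace.exp L = A + B ∧
      L * L = Real.arcosh p ^ 2 • specProj A p q - Real.arccos q ^ 2 • specProj A q p := by
  obtain ⟨K, hK, hPK, hKP, hKK, hKB⟩ := h.exists_boost_generator hqp hp
  obtain ⟨J, hJ, hQJ, hJQ, hJJ, hJB⟩ := h.exists_rotation_generator hqp hq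
  have hPQ := specProj_mul_specProj h.quadratic'
  have hQP := specProj_mul_specProj h.quadratic
  have hJP : J * specProj A p q = 0 := by rw [← hJQ, mul_assoc, hQP, mul_zero]
  have hKQ : K * specProj A q p = 0 := by rw [← hKP, mul_assoc, hPQ, mul_zero]
  have hJK : J * K = 0 := by rw [← hPK, ← mul_assoc, hJP, zero_mul]
  have hKJ : K * J = 0 := by rw [← hQJ, ← mul_assoc, hKQ, zero_mul]
  refine ⟨Real.arcosh p • K + Real.arccos q • J, (hK.smul _).add (hJ.smul _), ?_, ?_⟩
  · rw [exp_eq_of_blocks (P := specProj A p q) (Q := specProj A q p) (K := K) (J := J)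
      (a := Real.arcosh p) (b := Real.arccos q), Real.cosh_arcosh h.bounds.1,
      Real.cos_arccos h.bounds.2.1 h.bounds.2.2, add_eq_specProj (A := A) (B := B) hqp, hKB, hJB]
    · rw [add_mul, Matrix.smul_mul, Matrix.smul_mul, hKP, hJP, smul_zero, add_zero]
    · rw [add_mul, Matrix.smul_mul, Matrix.smul_mul, hKK, hJK, smul_zero, add_zero]
    · rw [add_mul, Matrix.smul_mul, Matrix.smul_mul, hKQ, hJQ, smul_zero, zero_add]
    · rw [add_mul, Matrix.smul_mul, Matrix.smul_mul, hKJ, hJJ, smul_zero, zero_add, smul_neg]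
    · exact specProj_add_specProj hqp.ne'
  · simp only [add_mul, mul_add, Matrix.smul_mul, Matrix.mul_smul, hKK, hJK, hKJ, hJJ]
    module

end IsEvenOddPair

/-! ### Existence of a logarithm with the prescribed invariants. -/

theorem IsLorentzMetric.isUnit_det {g : Mat4} (hg : IsLorentzMetric g) : IsUnit g.det :=
  isUnit_iff_ne_zero.2 hg.2.ne

/-- The larger eigenvalue `(tr Λ + √Δ) / 4` of the even part of `Λ`. -/
def eigPlus (Λ : Mat4) : ℝ := (Λ.trace + √(lorentzDisc Λ)) / 4

/-- The smaller eigenvalue `(tr Λ - √Δ) / 4` of the even part of `Λ`. -/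
def eigMinus (Λ : Mat4) : ℝ := (Λ.trace - √(lorentzDisc Λ)) / 4

theorem lorentzDisc_nonneg {g Λ : Mat4} (hg : IsLorentzMetric g) (hΛ : Λ ∈ properLorentz g) :
    0 ≤ lorentzDisc Λ := by
  have h1 := (isBivector_oddPart hΛ).det_nonpos hg
  rw [det_oddPart hg.isUnit_det hΛ] at h1
  have h2 : |genTrace 2 Λ + 2| ≤ |2 * Λ.trace| := sq_le_sq.1 (by linarith)
  rw [abs_mul, abs_two] at h2
  have h3 := (le_abs_self _).trans h2
  rw [lorentzDisc, ← sq_abs Λ.trace]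
  -- The bound `tr₂ Λ ≤ 2|tr Λ| - 2` yields `Δ ≥ (|tr Λ| - 4)²`.
  nlinarith [sq_nonneg (|Λ.trace| - 4)]

theorem isEvenOddPair {g Λ : Mat4} (hg : IsLorentzMetric g) (hm : IsMostlyPlus g)
    (hΛ : Λ ∈ properOrthochronous g) :
    IsEvenOddPair g (evenPart Λ) (oddPart Λ) (eigPlus Λ) (eigMinus Λ) := by
  have hmem := mem_properLorentz hΛ
  have hd := hg.isUnit_det
  have hD := lorentzDisc_nonneg hg hmem
  have hs := Real.sqrt_nonneg (lorentzDisc Λ)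
  have hsq := Real.mul_self_sqrt hD
  have hsum : eigPlus Λ + eigMinus Λ = Λ.trace / 2 := by rw [eigPlus, eigMinus]; ring
  have hprod : eigPlus Λ * eigMinus Λ = (genTrace 2 Λ - 2) / 4 := by
    have : eigPlus Λ * eigMinus Λ =
      (Λ.trace ^ 2 - √(lorentzDisc Λ) * √(lorentzDisc Λ)) / 16 := by rw [eigPlus, eigMinus]; ring
    rw [this, hsq, lorentzDisc]
    ring
  refine ⟨hg.1, hd, hm, evenPart_selfAdjoint hmem, isBivector_oddPart hmem,
    evenPart_mul_oddPart hmem, oddPart_sq hmem, ?_, ?_, fun v hv => ?_, ?_, ?_⟩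
  · rw [evenPart_quadratic hd hmem, hsum, hprod]
  · rw [trace_evenPart hd hmem, hsum]; ring
  · have h1 := form_mulVec_self_neg hg.1 hm hΛ hv
    have h2 : form g v (Λ⁻¹ *ᵥ v) = form g v (Λ *ᵥ v) := by
      rw [form_mulVec_right, ← transpose_mul_of_mem hmem, ← form_mulVec_left, form_comm hg.1]
    rw [evenPart, smul_mulVec, add_mulVec, form_smul_right, form_add_right, h2]
    linarith
  · have h1 := (isBivector_oddPart hmem).det_nonpos hg
    rw [det_oddPart hd hmem] at h1
    have h2 : (1 - eigPlus Λ ^ 2) * (1 - eigMinus Λ ^ 2) = (1 + eigPlus Λ * eigMinus Λ) ^ 2 -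
      (eigPlus Λ + eigMinus Λ) ^ 2 := by ring
    rw [h2, hsum, hprod]
    linarith
  · rw [eigPlus, eigMinus]; linarith

theorem isSimpleBivector_neg {g L : Mat4} : IsSimpleBivector (-g) L ↔ IsSimpleBivector g L := by
  have : ∀ u v, wedge (-g) u v = wedge g v u := fun u v => by
    rw [wedge, wedge]; noncomm_ring
  simp only [IsSimpleBivector, this]
  exact exists_comm

theorem isBivector_neg {g L : Mat4} : IsBivector (-g) L ↔ IsBivector g L := by
  rw [IsBivector, IsBivector, mul_neg, neg_mul, ← neg_add, neg_eq_zero]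

theorem isLorentzMetric_neg {g : Mat4} (hg : IsLorentzMetric g) : IsLorentzMetric (-g) := by
  refine ⟨hg.1.neg, ?_⟩
  rw [det_neg, Fintype.card_fin]
  have := hg.2
  linarith

theorem properOrthochronous_neg (g : Mat4) : properOrthochronous (-g) = properOrthochronous g := by
  have : properLorentz (-g) = properLorentz g := by
    ext Λ
    simp [properLorentz]
  rw [properOrthochronous, properOrthochronous, this]

theorem IsBivector.det_eq_of_sq {g L P Q : Mat4} {m n : ℝ} (hd : IsUnit g.det)
    (hL : IsBivector g L) (hsq : L * L = m • P + n • Q) (hP : P * P = P) (hQP : Q * P = 0)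
    (htP : P.trace = 2) (htQ : Q.trace = 2) :
    genTrace 2 L = -(m + n) ∧ L.det = m * n := by
  have h1 : genTrace 2 L = -(m + n) := by
    rw [hL.genTrace_two hd, hsq, trace_add, trace_smul, trace_smul, htP, htQ, smul_eq_mul,
      smul_eq_mul]
    ring
  refine ⟨h1, ?_⟩
  have h2 := hL.cayleyHamilton hd
  have h3 : L * L * P = m • P := by
    rw [hsq, add_mul, Matrix.smul_mul, Matrix.smul_mul, hP, hQP, smul_zero, add_zero]
  have h4 : L ^ 4 * P = m ^ 2 • P := by
    rw [show L ^ 4 = (L * L) * (L * L) by noncomm_ring, mul_assoc, h3, Matrix.mul_smul, h3,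
      smul_smul, _root_.sq]
  -- Tracing Cayley–Hamilton on the image of `P` gives `m² - (m + n) m + det L = 0`.
  have h5 := congrArg (fun M => (M * P).trace) h2
  simp only [add_mul, Matrix.smul_mul, h4, pow_two L, h3, one_mul, zero_mul, trace_zero, trace_add,
    trace_smul, htP, smul_eq_mul, h1] at h5
  linarith

theorem exists_log_of_isMostlyPlus {g Λ : Mat4} (hg : IsLorentzMetric g) (hm : IsMostlyPlus g)
    (hΛ : Λ ∈ properOrthochronous g) (hns : ¬ IsSimpleLorentz g Λ) :
    1 < eigPlus Λ ∧ -1 ≤ eigMinus Λ ∧ eigMinus Λ < 1 ∧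
    ∃ L, IsBivector g L ∧ NormedSpace.exp L = Λ ∧
      genTrace 2 L = -(rapidity Λ ^ 2 + -angle Λ ^ 2) ∧
      L.det = rapidity Λ ^ 2 * -angle Λ ^ 2 := by
  have h := isEvenOddPair hg hm hΛ
  obtain ⟨h1, h2, h3⟩ := h.bounds
  have hadd := evenPart_add_oddPart Λ
  rw [← hadd] at hns
  have hlt : eigMinus Λ < eigPlus Λ :=
    lt_of_le_of_ne h.le fun he => hns (h.isSimpleLorentz_of_eq he)
  have hp : 1 < eigPlus Λ := lt_of_le_of_ne h1 fun he => hns (h.isSimpleLorentz_of_left hlt he.symm)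
  have hq : eigMinus Λ < 1 := lt_of_le_of_ne h3 fun he => hns (h.isSimpleLorentz_of_right hlt he)
  refine ⟨hp, h2, hq, ?_⟩
  obtain ⟨L, hL, hexp, hLL⟩ := h.exists_log hlt hp hq
  refine ⟨L, hL, hexp.trans hadd, ?_⟩
  rw [sub_eq_add_neg, ← neg_smul] at hLL
  exact hL.det_eq_of_sq hg.isUnit_det hLL (specProj_mul_self hlt.ne' h.quadratic)
    (specProj_mul_specProj h.quadratic) (trace_specProj hlt.ne' h.trace_eq)
    (trace_specProj hlt.ne h.trace_eq')

/-- Replacing `g` by `-g` changes neither the bivectors, the simple ones nor the group, so either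
signature convention reduces to mostly plus. -/
theorem exists_log {g Λ : Mat4} (hg : IsLorentzMetric g) (hΛ : Λ ∈ properOrthochronous g)
    (hns : ¬ IsSimpleLorentz g Λ) :
    1 < eigPlus Λ ∧ -1 ≤ eigMinus Λ ∧ eigMinus Λ < 1 ∧
    ∃ L, IsBivector g L ∧ NormedSpace.exp L = Λ ∧
      genTrace 2 L = -(rapidity Λ ^ 2 + -angle Λ ^ 2) ∧
      L.det = rapidity Λ ^ 2 * -angle Λ ^ 2 := by
  rcases isMostlyPlus_or_neg hg with hm | hm
  · exact exists_log_of_isMostlyPlus hg hm hΛ hns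
  · have := exists_log_of_isMostlyPlus (Λ := Λ) (isLorentzMetric_neg hg) hm
      (by rwa [properOrthochronous_neg]) (by simpa only [IsSimpleLorentz, isSimpleBivector_neg])
    simpa only [isBivector_neg] using this

/-! ### Projections of an arbitrary nonsimple logarithm. -/

theorem mu_eq {L : Mat4} {m n : ℝ} (hmn : n ≤ m) (ht : genTrace 2 L = -(m + n))
    (hdet : L.det = m * n) : muPlus L = m ∧ muMinus L = n := by
  have h : √(genTrace 2 L ^ 2 - 4 * L.det) = m - n := by
    rw [ht, hdet, show (-(m + n)) ^ 2 - 4 * (m * n) = (m - n) ^ 2 by ring]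
    exact Real.sqrt_sq (by linarith)
  rw [muPlus, muMinus, h, ht]
  constructor <;> ring

theorem projPlus_eq (L : Mat4) : projPlus L = specProj (L * L) (muPlus L) (muMinus L) := by
  rw [projPlus, specProj, pow_two]

theorem projMinus_eq (L : Mat4) : projMinus L = specProj (L * L) (muMinus L) (muPlus L) := by
  rw [projMinus, specProj, pow_two, ← neg_sub (muPlus L), inv_neg, neg_smul]

theorem IsNonsimpleBivector.det_neg {g L : Mat4} (hg : IsLorentzMetric g)
    (hL : IsNonsimpleBivector g L) : L.det < 0 :=
  lt_of_le_of_ne (hL.1.det_nonpos hg) fun h => hL.2 (hL.1.isSimple hg.1 hg.isUnit_det h)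

theorem mu_props {L : Mat4} (hdet : L.det < 0) : 0 < muPlus L ∧ muMinus L < 0 ∧
    muPlus L + muMinus L = -genTrace 2 L ∧ muPlus L * muMinus L = L.det := by
  have h1 : 0 ≤ genTrace 2 L ^ 2 - 4 * L.det := by nlinarith [sq_nonneg (genTrace 2 L)]
  have h2 := Real.mul_self_sqrt h1
  have h3 : |genTrace 2 L| < √(genTrace 2 L ^ 2 - 4 * L.det) := by
    rw [← Real.sqrt_sq_eq_abs]
    exact Real.sqrt_lt_sqrt (sq_nonneg _) (by linarith)
  obtain ⟨h4, h5⟩ := abs_lt.1 h3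
  simp only [muPlus, muMinus]
  refine ⟨by linarith, by linarith, by ring, by linarith⟩

/-- Passing to `-L` keeps the blocks `P, Q` and negates the generators `L P / √m` and `L Q / √(-n)`,
so the `sinh` and `sin` terms cancel. -/
theorem evenPart_exp {L P Q : Mat4} {m n : ℝ} (hm : 0 < m) (hn : n < 0)
    (hP : L * L * P = m • P) (hQ : L * L * Q = n • Q) (h1 : P + Q = 1) :
    evenPart (NormedSpace.exp L) = Real.cosh √m • P + Real.cos √(-n) • Q := by
  have ha : √m ≠ 0 := (Real.sqrt_pos.2 hm).ne'
  have hb : √(-n) ≠ 0 := (Real.sqrt_pos.2 (neg_pos.2 hn)).ne'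
  have ha2 : (√m)⁻¹ * m = √m := by
    field_simp
    exact (Real.sq_sqrt hm.le).symm
  have hb2 : (√(-n))⁻¹ * n = -√(-n) := by
    field_simp
    rw [Real.sq_sqrt (neg_pos.2 hn).le, neg_neg]
  have hK : L * ((√m)⁻¹ • (L * P)) = √m • P := by
    rw [Matrix.mul_smul, ← mul_assoc, hP, smul_smul, ha2]
  have hJ : L * ((√(-n))⁻¹ • (L * Q)) = -(√(-n) • Q) := by
    rw [Matrix.mul_smul, ← mul_assoc, hQ, smul_smul, hb2, neg_smul]
  have e1 := exp_eq_of_blocks (L := L) (P := P) (K := (√m)⁻¹ • (L * P)) (Q := Q)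
    (J := (√(-n))⁻¹ • (L * Q)) (a := √m) (b := √(-n)) (smul_inv_smul₀ ha _).symm hK
    (smul_inv_smul₀ hb _).symm hJ h1
  have e2 := exp_eq_of_blocks (L := -L) (P := P) (K := -((√m)⁻¹ • (L * P))) (Q := Q)
    (J := -((√(-n))⁻¹ • (L * Q))) (a := √m) (b := √(-n))
    (by rw [smul_neg, smul_inv_smul₀ ha, neg_mul]) (by rw [neg_mul_neg, hK])
    (by rw [smul_neg, smul_inv_smul₀ hb, neg_mul]) (by rw [neg_mul_neg, hJ]) h1
  rw [evenPart, ← Matrix.exp_neg, e1, e2]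
  module

theorem eig_eq {Λ : Mat4} {c d : ℝ} (hcd : d ≤ c) (ht : Λ.trace = 2 * (c + d))
    (hs : genTrace 2 Λ = 2 + 4 * (c * d)) : eigPlus Λ = c ∧ eigMinus Λ = d := by
  have h : √(lorentzDisc Λ) = 2 * (c - d) := by
    rw [lorentzDisc, ht, hs,
      show (2 * (c + d)) ^ 2 - 4 * (2 + 4 * (c * d)) + 8 = (2 * (c - d)) ^ 2 by ring]
    exact Real.sqrt_sq (by linarith)
  rw [eigPlus, eigMinus, h, ht]
  constructor <;> ring

/-- Since `cos ≤ 1 < cosh √μ₊`, the even part of `exp L` has distinct eigenvalues on the images of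
`P₊, P₋`. Traces identify them, in order, with `eigPlus` and `eigMinus`, for any choice of
logarithm. -/
theorem IsNonsimpleBivector.eig_exp {g L : Mat4} (hg : IsLorentzMetric g)
    (hL : IsNonsimpleBivector g L) (hΛ : NormedSpace.exp L ∈ properLorentz g) :
    muMinus L < muPlus L ∧ eigMinus (NormedSpace.exp L) < eigPlus (NormedSpace.exp L) ∧
    projPlus L = specProj (evenPart (NormedSpace.exp L))
      (eigPlus (NormedSpace.exp L)) (eigMinus (NormedSpace.exp L)) ∧
    projMinus L = specProj (evenPart (NormedSpace.exp L))
      (eigMinus (NormedSpace.exp L)) (eigPlus (NormedSpace.exp L)) := by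
  obtain ⟨hm, hn, hsum, hprod⟩ := mu_props (hL.det_neg hg)
  have hd := hg.isUnit_det
  have hlt : muMinus L < muPlus L := hn.trans hm
  have hq : (L * L) * (L * L) =
      (muPlus L + muMinus L) • (L * L) - (muPlus L * muMinus L) • (1 : Mat4) := by
    have := hL.1.cayleyHamilton hd
    rw [show L ^ 4 = (L * L) * (L * L) by noncomm_ring, pow_two] at this
    rw [hsum, hprod, ← sub_eq_zero, ← this]
    module
  have hq' : (L * L) * (L * L) =
      (muMinus L + muPlus L) • (L * L) - (muMinus L * muPlus L) • (1 : Mat4) := by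
    rw [hq, add_comm (muPlus L), mul_comm (muPlus L)]
  have htr : (L * L).trace = 2 * (muPlus L + muMinus L) := by
    rw [hsum, hL.1.genTrace_two hd]; ring
  have hA := evenPart_exp hm hn (mul_specProj hq) (mul_specProj hq') (specProj_add_specProj hlt.ne')
  set P := specProj (L * L) (muPlus L) (muMinus L) with hPdef
  set Q := specProj (L * L) (muMinus L) (muPlus L) with hQdef
  have hPP : P * P = P := specProj_mul_self hlt.ne' hq
  have hQQ : Q * Q = Q := specProj_mul_self hlt.ne hq'
  have hQP : Q * P = 0 := specProj_mul_specProj hq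
  have hPQ : P * Q = 0 := specProj_mul_specProj hq'
  have hPQ1 : P + Q = 1 := specProj_add_specProj hlt.ne'
  have htP : P.trace = 2 := trace_specProj hlt.ne' htr
  have htQ : Q.trace = 2 := trace_specProj hlt.ne (by rw [htr, add_comm])
  have hcd : Real.cos √(-muMinus L) < Real.cosh √(muPlus L) :=
    (Real.cos_le_one _).trans_lt (Real.one_lt_cosh.2 (Real.sqrt_pos.2 hm).ne')
  rw [projPlus_eq, projMinus_eq, ← hPdef, ← hQdef]
  generalize Real.cos √(-muMinus L) = d at *
  generalize Real.cosh √(muPlus L) = c at *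
  have ht : (NormedSpace.exp L).trace = 2 * (c + d) := by
    rw [← trace_evenPart hd hΛ, hA, trace_add, trace_smul, trace_smul, htP, htQ, smul_eq_mul,
      smul_eq_mul]
    ring
  have hs : genTrace 2 (NormedSpace.exp L) = 2 + 4 * (c * d) := by
    have h1 := congrArg trace (evenPart_quadratic hd hΛ)
    rw [trace_sub, trace_smul, trace_smul, trace_evenPart hd hΛ, ht, hA] at h1
    simp only [add_mul, mul_add, Matrix.smul_mul, Matrix.mul_smul, hPP, hQQ, hPQ, hQP, trace_add,
      trace_smul, htP, htQ, trace_one, Fintype.card_fin, smul_eq_mul, smul_zero, trace_zero] at h1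
    push_cast at h1
    linarith
  obtain ⟨h1, h2⟩ := eig_eq hcd.le ht hs
  rw [h1, h2, hA]
  have hne : c - d ≠ 0 := sub_ne_zero.2 hcd.ne'
  have hne' : d - c ≠ 0 := sub_ne_zero.2 hcd.ne
  refine ⟨hlt, hcd, ?_, ?_⟩
  · rw [specProj, ← hPQ1, show c • P + d • Q - d • (P + Q) = (c - d) • P by module,
      inv_smul_smul₀ hne]
  · rw [specProj, ← hPQ1, show c • P + d • Q - c • (P + Q) = (d - c) • Q by module,
      inv_smul_smul₀ hne']

end LorentzBivector

end

theorem mainTheorem3 (g : LorentzBivector.Mat4) (hg : LorentzBivector.IsLorentzMetric g)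
    (Λ : LorentzBivector.Mat4) (hΛ : Λ ∈ LorentzBivector.properOrthochronous g)
    (hns : ¬ LorentzBivector.IsSimpleLorentz g Λ) :
    -- the quantities defining `c₊`, `c₋` lie in the domains of `√`, `cosh⁻¹`, `cos⁻¹`
    0 ≤ LorentzBivector.lorentzDisc Λ ∧
    1 ≤ (Λ.trace + √(LorentzBivector.lorentzDisc Λ)) / 4 ∧
    (Λ.trace - √(LorentzBivector.lorentzDisc Λ)) / 4 ∈ Set.Icc (-1 : ℝ) 1 ∧
    LorentzBivector.cMinus Λ < LorentzBivector.cPlus Λ ∧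
    -- `Λ` has a nonsimple logarithm, with `μ₊`, `μ₋` the ones computed from `Λ`
    (∃ L : LorentzBivector.Mat4, LorentzBivector.IsNonsimpleBivector g L ∧
      Λ = NormedSpace.exp L ∧
      √(LorentzBivector.muPlus L) = LorentzBivector.rapidity Λ ∧
      √(-LorentzBivector.muMinus L) = LorentzBivector.angle Λ) ∧
    -- the projections of any nonsimple logarithm
    (∀ L : LorentzBivector.Mat4, LorentzBivector.IsNonsimpleBivector g L →
      Λ = NormedSpace.exp L →
      LorentzBivector.muMinus L < LorentzBivector.muPlus L ∧
      LorentzBivector.projPlus L =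
        (LorentzBivector.cPlus Λ - LorentzBivector.cMinus Λ)⁻¹ •
          ((1 / 2 : ℝ) • (Λ + Λ⁻¹) -
            LorentzBivector.cMinus Λ • (1 : LorentzBivector.Mat4)) ∧
      LorentzBivector.projMinus L =
        -((LorentzBivector.cPlus Λ - LorentzBivector.cMinus Λ)⁻¹ •
          ((1 / 2 : ℝ) • (Λ + Λ⁻¹) -
            LorentzBivector.cPlus Λ • (1 : LorentzBivector.Mat4)))) := by
  open LorentzBivector in
  have hmem := mem_properLorentz hΛ
  obtain ⟨hp, hq1, hq, L, hL, hexp, htr, hdet⟩ := exists_log hg hΛ hns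
  have hlt := hq.trans hp
  have hcp : cPlus Λ = eigPlus Λ := Real.cosh_arcosh hp.le
  have hcm : cMinus Λ = eigMinus Λ := Real.cos_arccos hq1 hq.le
  have ha : 0 < rapidity Λ := Real.arcosh_pos hp
  have hb : 0 < LorentzBivector.angle Λ := Real.arccos_pos.2 hq
  rw [hcp, hcm]
  refine ⟨lorentzDisc_nonneg hg hmem, hp.le, ⟨hq1, hq.le⟩, hlt, ⟨L, ?_⟩, ?_⟩
  · obtain ⟨h1, h2⟩ := mu_eq (by nlinarith) htr hdet
    refine ⟨⟨hL, ?_⟩, hexp.symm, ?_, ?_⟩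
    -- A simple bivector has determinant zero, whereas here it is minus the product of two positive
    -- squares.
    · rintro ⟨u, v, rfl⟩
      rw [det_wedge] at hdet
      nlinarith [mul_pos (pow_pos ha 2) (pow_pos hb 2)]
    · rw [h1, Real.sqrt_sq ha.le]
    · rw [h2, neg_neg, Real.sqrt_sq hb.le]
  · intro L hL hexp'
    subst hexp'
    obtain ⟨h1, -, h3, h4⟩ := hL.eig_exp hg hmem
    refine ⟨h1, h3, ?_⟩
    rw [h4, specProj, ← neg_sub (eigPlus _), inv_neg, neg_smul]
    rfl
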